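/- Let $\Omega\subset\mathbb{R}^{D}$ be a bounded connected open set with boundary of class $C^1$ (lying locally on one side of its boundary), with unit outward normal $\mathbf{n}$. Let $\nu>0$, $\lambda\ge 0$, and let $I\subset\mathbb{R}$ be an interval with least element $t_0$ (for example $[t_0,T)$ or $[t_0,\infty)$). For a vector field $\mathbf{w}$ write $\mathbf{u}=\mathscr{P}\mathbf{w}$ (Leray–Helmholtz projection) if $\mathbf{w}=\mathbf{u}+\nabla\psi$ in $\Omega$ for some scalar field $\psi$, $\nabla\cdot\mathbf{u}=0$ in $\Omega$, and $\mathbf{u}\cdot\mathbf{n}=0$ on $\partial\Omega$. Let $(\mathbf{u},\mathbf{w},q)$ be a classical solution, for $t\in I$, of the GePUP-E formulation of the incompressible Navier–Stokes equations on the no-slip domain $\Omega$ with body force $\mathbf{g}$: $$ \begin{aligned} \partial_t\mathbf{w} &= \mathbf{g}-\mathbf{u}\cdot\nabla\mathbf{u}-\nabla q+\nu\Delta\mathbf{w} &&\text{in }\Omega,\\ \mathbf{w}\cdot\boldsymbol{\tau}&=0\ \text{ for all tangent vectors }\boldsymbol\tau,\qquad \nabla\cdot\mathbf{w}=0 &&\text{on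 }\partial\Omega,\\ \mathbf{u}&=\mathscr{P}\mathbf{w} &&\text{in }\Omega,\\ \mathbf{u}\cdot\mathbf{n}&=0 &&\text{on }\partial\Omega,\\ \Delta q&=\nabla\cdot(\mathbf{g}-\mathbf{u}\cdot\nabla\mathbf{u}) &&\text{in }\Omega,\\ \mathbf{n}\cdot\nabla q&=\mathbf{n}\cdot(\mathbf{g}-\mathbf{u}\cdot\nabla\mathbf{u}+\nu\Delta\mathbf{w})+\lambda\,\mathbf{n}\cdot\mathbf{w} &&\text{on }\partial\Omega, \end{aligned} $$ with $\mathbf{w}(\mathbf{x},t_0)=\mathbf{u}(\mathbf{x},t_0)$ for all $\mathbf{x}\in\overline{\Omega}$. Here "classical" means that, up to the boundary (i.e. as restrictions of functions of the given class on a neighbourhood), $\mathbf{w}$ is $C^2$ in $(t,\mathbf{x})$ on $I\times\overline\Omega$, and for each $t\in I$ the functions $\mathbf{w}(t),\mathbf{u}(t),q(t),\mathbf{g}(t)$ are respectively $C^3$, $C^2$, $C^2$, $C^1$ in $\mathbf{x}$ on $\overline\Omega$. Suppose the body force is conservative: for each $t\in I$, $\mathbf{g}(t)=-\nabla\varphi(t)$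 in $\Omega$ for some scalar field $\varphi(t)$. Then the kinetic energy $E_{\mathrm{kinetic}}(t)=\frac12\int_\Omega \mathbf{u}\cdot\mathbf{u}\,\mathrm{d}V$ is differentiable on $I$ (one-sidedly at end points of $I$), and for every $t\in I$ $$\frac{\mathrm{d}}{\mathrm{d}t}E_{\mathrm{kinetic}} = -\nu\|\nabla\mathbf{u}\|^2 := -\nu\sum_{i=1}^{D}\sum_{j=1}^{D}\int_\Omega\left|\frac{\partial u_i}{\partial x_j}\right|^2\mathrm{d}V .$$ -/

import Mathlib

open MeasureTheory Set Topology
open scoped Gradient Laplacian RealInnerProductSpace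

noncomputable section

namespace GePUPE

/-- `ρ` is a local `C¹` defining function of the set `Ω` near the point `p`: near `p` the set `Ω`
is exactly `{ρ < 0}`, and `ρ` vanishes at `p` with nonzero gradient. -/
structure IsDefiningFunctionAt {D : ℕ} (Ω : Set (EuclideanSpace ℝ (Fin D)))
    (p : EuclideanSpace ℝ (Fin D)) (ρ : EuclideanSpace ℝ (Fin D) → ℝ) : Prop where
  contDiffAt : ContDiffAt ℝ 1 ρ p
  eq_zero : ρ p = 0
  gradient_ne_zero : ∇ ρ p ≠ 0
  mem_iff : ∀ᶠ x in 𝓝 p, x ∈ Ω ↔ ρ x < 0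

/-- A bounded connected open subset of `ℝ^D` with boundary of class `C¹`, lying locally on one
side of its boundary. -/
structure IsC1Domain {D : ℕ} (Ω : Set (EuclideanSpace ℝ (Fin D))) : Prop where
  isOpen : IsOpen Ω
  isConnected : IsConnected Ω
  isBounded : Bornology.IsBounded Ω
  exists_definingFunction : ∀ p ∈ frontier Ω, ∃ ρ, IsDefiningFunctionAt Ω p ρ

/-- `n` is the unit outward normal of `∂Ω` at `p`: the normalised gradient of a local defining
function of `Ω` near `p`. -/
def IsUnitOuterNormal {D : ℕ} (Ω : Set (EuclideanSpace ℝ (Fin D)))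
    (p n : EuclideanSpace ℝ (Fin D)) : Prop :=
  ∃ ρ, IsDefiningFunctionAt Ω p ρ ∧ n = ‖∇ ρ p‖⁻¹ • ∇ ρ p

/-- A domain of class `C¹` has a unit outward normal at each of its boundary points. -/
theorem IsC1Domain.exists_isUnitOuterNormal {D : ℕ} {Ω : Set (EuclideanSpace ℝ (Fin D))}
    (hΩ : IsC1Domain Ω) {p : EuclideanSpace ℝ (Fin D)} (hp : p ∈ frontier Ω) :
    ∃ n, IsUnitOuterNormal Ω p n ∧ ‖n‖ = 1 := by
  obtain ⟨ρ, hρ⟩ := hΩ.exists_definingFunction p hp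
  exact ⟨_, ⟨ρ, hρ, rfl⟩, norm_smul_inv_norm (𝕜 := ℝ) hρ.gradient_ne_zero⟩

/-- The partial derivative `∂vᵢ/∂xⱼ` of the `i`-th component of a vector field. -/
def partialDeriv {D : ℕ} (i j : Fin D)
    (v : EuclideanSpace ℝ (Fin D) → EuclideanSpace ℝ (Fin D))
    (x : EuclideanSpace ℝ (Fin D)) : ℝ :=
  (fderiv ℝ v x (EuclideanSpace.single j 1)) i

/-- The divergence `∇ · v = ∑ᵢ ∂vᵢ/∂xᵢ`. -/
def divergence {D : ℕ} (v : EuclideanSpace ℝ (Fin D) → EuclideanSpace ℝ (Fin D))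
    (x : EuclideanSpace ℝ (Fin D)) : ℝ :=
  ∑ i, partialDeriv i i v x

/-- The convection term `v · ∇v`, with components `∑ⱼ vⱼ ∂vᵢ/∂xⱼ`. -/
def convection {D : ℕ} (v : EuclideanSpace ℝ (Fin D) → EuclideanSpace ℝ (Fin D))
    (x : EuclideanSpace ℝ (Fin D)) : EuclideanSpace ℝ (Fin D) :=
  fderiv ℝ v x (v x)

/-- `v = 𝒫 v'`, where `𝒫` is the Leray-Helmholtz projection of `Ω` with no-penetration boundary
data: `v' = v + ∇φ` in `Ω` for some scalar field `φ`, where `∇ · v = 0` in `Ω` and `v · n = 0` on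
`∂Ω`. -/
structure IsLerayProjection {D : ℕ} (Ω : Set (EuclideanSpace ℝ (Fin D)))
    (v' v : EuclideanSpace ℝ (Fin D) → EuclideanSpace ℝ (Fin D)) : Prop where
  decomposition : ∃ φ : EuclideanSpace ℝ (Fin D) → ℝ, ∀ x ∈ Ω, HasGradientAt φ (v' x - v x) x
  divergence_eq_zero : ∀ x ∈ Ω, divergence v x = 0
  normal_eq_zero : ∀ x ∈ frontier Ω, ∀ n, IsUnitOuterNormal Ω x n → ⟪v x, n⟫ = 0

/-- `(u, w, q)` is a classical solution, on the time interval `I` with initial time `t₀`, of the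
GePUP-E formulation in `Ω` with body force `g`, viscosity `ν` and penalty parameter `lam`.

Regularity up to the boundary is expressed by `ContDiffAt` at all points of the closure of `Ω`
(and at all times of `I`): the fields are restrictions of fields that are of the given class in a
neighbourhood, and the derivatives at boundary points are those of such an extension. -/
structure IsSolution {D : ℕ} (Ω : Set (EuclideanSpace ℝ (Fin D))) (I : Set ℝ) (t₀ ν lam : ℝ)
    (g u w : ℝ → EuclideanSpace ℝ (Fin D) → EuclideanSpace ℝ (Fin D))
    (q : ℝ → EuclideanSpace ℝ (Fin D) → ℝ) : Prop where
  /-- `w` is of class `C²` jointly in time and space. -/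
  contDiffAt_w : ∀ t ∈ I, ∀ x ∈ closure Ω,
    ContDiffAt ℝ 2 (fun z : ℝ × EuclideanSpace ℝ (Fin D) => w z.1 z.2) (t, x)
  /-- `w` is of class `C³` in space. -/
  contDiffAt_w_space : ∀ t ∈ I, ∀ x ∈ closure Ω, ContDiffAt ℝ 3 (w t) x
  contDiffAt_u : ∀ t ∈ I, ∀ x ∈ closure Ω, ContDiffAt ℝ 2 (u t) x
  contDiffAt_q : ∀ t ∈ I, ∀ x ∈ closure Ω, ContDiffAt ℝ 2 (q t) x
  contDiffAt_g : ∀ t ∈ I, ∀ x ∈ closure Ω, ContDiffAt ℝ 1 (g t) x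
  /-- `∂w/∂t = g - u · ∇u - ∇q + ν Δw` in `Ω`. -/
  momentum : ∀ t ∈ I, ∀ x ∈ Ω,
    deriv (fun s => w s x) t = g t x - convection (u t) x - ∇ (q t) x + ν • Δ (w t) x
  /-- `w · τ = 0` on `∂Ω`, for all tangent vectors `τ`. -/
  tangential_w : ∀ t ∈ I, ∀ x ∈ frontier Ω, ∀ n, IsUnitOuterNormal Ω x n →
    ∀ τ : EuclideanSpace ℝ (Fin D), ⟪τ, n⟫ = 0 → ⟪w t x, τ⟫ = 0
  /-- `∇ · w = 0` on `∂Ω`. -/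
  divergence_w : ∀ t ∈ I, ∀ x ∈ frontier Ω, divergence (w t) x = 0
  /-- `u = 𝒫 w` in `Ω`. -/
  projection : ∀ t ∈ I, IsLerayProjection Ω (w t) (u t)
  /-- `u · n = 0` on `∂Ω`. -/
  normal_u : ∀ t ∈ I, ∀ x ∈ frontier Ω, ∀ n, IsUnitOuterNormal Ω x n → ⟪u t x, n⟫ = 0
  /-- `Δq = ∇ · (g - u · ∇u)` in `Ω`. -/
  poisson_q : ∀ t ∈ I, ∀ x ∈ Ω,
    Δ (q t) x = divergence (fun y => g t y - convection (u t) y) x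
  /-- `n · ∇q = n · (g - u · ∇u + ν Δw) + λ n · w` on `∂Ω`. -/
  neumann_q : ∀ t ∈ I, ∀ x ∈ frontier Ω, ∀ n, IsUnitOuterNormal Ω x n →
    ⟪n, ∇ (q t) x⟫ = ⟪n, g t x - convection (u t) x + ν • Δ (w t) x⟫ + lam * ⟪n, w t x⟫
  /-- `w` and `u` have the same initial condition in the closure of `Ω`. -/
  initial : ∀ x ∈ closure Ω, w t₀ x = u t₀ x

/-- The body force `g` is conservative in `Ω` at the times of `I`: `g = -∇φ` for some scalar
field `φ`. -/
def IsConservative {D : ℕ} (Ω : Set (EuclideanSpace ℝ (Fin D))) (I : Set ℝ)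
    (g : ℝ → EuclideanSpace ℝ (Fin D) → EuclideanSpace ℝ (Fin D)) : Prop :=
  ∃ φ : ℝ → EuclideanSpace ℝ (Fin D) → ℝ, ∀ t ∈ I, ∀ x ∈ Ω, HasGradientAt (φ t) (-g t x) x

/-- The kinetic energy `½ ∫_Ω v · v dV`. -/
def kineticEnergy {D : ℕ} (Ω : Set (EuclideanSpace ℝ (Fin D)))
    (v : EuclideanSpace ℝ (Fin D) → EuclideanSpace ℝ (Fin D)) : ℝ :=
  (1 / 2 : ℝ) * ∫ x in Ω, ⟪v x, v x⟫

/-- `‖∇v‖² = ∑ᵢ ∑ⱼ ∫_Ω |∂vᵢ/∂xⱼ|² dV`. -/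
def gradNormSq {D : ℕ} (Ω : Set (EuclideanSpace ℝ (Fin D)))
    (v : EuclideanSpace ℝ (Fin D) → EuclideanSpace ℝ (Fin D)) : ℝ :=
  ∑ i, ∑ j, ∫ x in Ω, |partialDeriv i j v x| ^ 2

end GePUPE

end

/-! The formulation evolves `w`, and the point is that `w` and `u` stay equal in `Ω`. Taking the
divergence of the momentum equation, the Poisson equation for `q` cancels everything but viscosity,
so `∇ · w` solves the heat equation with zero initial and boundary data and vanishes by the maximum
principle (`nonpos_of_heat_equation`, `IsSolution.divergence_w_eq_zero`). On `∂Ω` the Neumann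
condition for `q` reduces the normal momentum balance to `∂ₜ(w · n) = -λ w · n` with zero initial
value. Hence `w · n = 0`, and with the tangential condition `w = 0` on `∂Ω`. Now `w - u` is a
gradient, solenoidal and tangential to the boundary, therefore orthogonal to itself and zero
(`IsSolution.w_eq_u`).

For the energy, pair the momentum equation with `w` (`IsSolution.setIntegral_inner_deriv`). Force,
pressure and convection pair with `w` as the gradients of `-φ`, `q` and `½|w|²` do, and these are
orthogonal to `w`. The viscous term is `Δ(½|w|²) - |∇w|²`, whose first part integrates to zero
because `∇(½|w|²)` vanishes with `w` on `∂Ω`.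

All integrations by parts rest on a zero-flux divergence theorem, `IsFluxPair.setIntegral_eq_zero`,
proved with cutoffs and without surface integrals. The potentials are given only inside `Ω`, with no
bound; `setIntegral_inner_gradient_eq_zero` truncates them by `k arctan(ψ / k)` and lets `k → ∞`. -/

namespace GePUPE

open Filter

/-! ### Vector calculus and the divergence theorem for compactly supported fields. -/

section Calculus

variable {E F : Type*} [NormedAddCommGroup E] [NormedSpace ℝ E] [NormedAddCommGroup F]
  [NormedSpace ℝ F]

theorem _root_.ContDiffAt.continuousAt_fderiv_of_one {f : E → F} {x : E}
    (hf : ContDiffAt ℝ 1 f x) : ContinuousAt (fderiv ℝ f) x :=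
  (hf.fderiv_right (m := 0) (by norm_num)).continuousAt

theorem _root_.ContDiffAt.differentiableAt_of_one {f : E → F} {x : E}
    (hf : ContDiffAt ℝ 1 f x) : DifferentiableAt ℝ f x :=
  hf.differentiableAt (by norm_num)

/-- The integral of a directional derivative of a compactly supported `C¹` function vanishes. -/
theorem integral_fderiv_apply_eq_zero [FiniteDimensional ℝ E] [MeasurableSpace E] [BorelSpace E]
    (μ : Measure E) [μ.IsAddHaarMeasure] {f : E → ℝ} (hf : ContDiff ℝ 1 f)
    (hc : HasCompactSupport f) (e : E) : ∫ x, fderiv ℝ f x e ∂μ = 0 := by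
  have h1 : Continuous fun x => fderiv ℝ f x e :=
    (hf.continuous_fderiv (by norm_num)).clm_apply continuous_const
  have h2 : HasCompactSupport fun x => fderiv ℝ f x e := hc.fderiv_apply (𝕜 := ℝ) e
  -- Integration by parts against the constant function `1`.
  have := integral_mul_fderiv_eq_neg_fderiv_mul_of_integrable (μ := μ) (f := fun _ : E => (1 : ℝ))
    (g := f) (v := e) (by simp)
    (by simpa using h1.integrable_of_hasCompactSupport h2)
    (by simpa using hf.continuous.integrable_of_hasCompactSupport hc)
    (fun x _ => differentiableAt_const _) (fun x _ => hf.differentiable (by norm_num) x)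
  simpa using this

end Calculus

variable {D : ℕ}

theorem divergence_congr {v v' : EuclideanSpace ℝ (Fin D) → EuclideanSpace ℝ (Fin D)}
    {x : EuclideanSpace ℝ (Fin D)} (h : v =ᶠ[𝓝 x] v') : divergence v x = divergence v' x := by
  simp only [divergence, partialDeriv, h.fderiv_eq]

theorem divergence_add {v v' : EuclideanSpace ℝ (Fin D) → EuclideanSpace ℝ (Fin D)}
    {x : EuclideanSpace ℝ (Fin D)} (hv : DifferentiableAt ℝ v x) (hv' : DifferentiableAt ℝ v' x) :
    divergence (fun y => v y + v' y) x = divergence v x + divergence v' x := by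
  simp only [divergence, partialDeriv, fderiv_fun_add hv hv', ← Finset.sum_add_distrib]
  rfl

theorem divergence_sub {v v' : EuclideanSpace ℝ (Fin D) → EuclideanSpace ℝ (Fin D)}
    {x : EuclideanSpace ℝ (Fin D)} (hv : DifferentiableAt ℝ v x) (hv' : DifferentiableAt ℝ v' x) :
    divergence (fun y => v y - v' y) x = divergence v x - divergence v' x := by
  simp only [divergence, partialDeriv, fderiv_fun_sub hv hv', ← Finset.sum_sub_distrib]
  rfl

theorem sum_apply_smul_single (x : EuclideanSpace ℝ (Fin D)) :
    ∑ i, x i • EuclideanSpace.single i (1 : ℝ) = x := by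
  simpa using (EuclideanSpace.basisFun (Fin D) ℝ).sum_repr x

theorem divergence_smul {c : EuclideanSpace ℝ (Fin D) → ℝ}
    {v : EuclideanSpace ℝ (Fin D) → EuclideanSpace ℝ (Fin D)}
    {x : EuclideanSpace ℝ (Fin D)} (hc : DifferentiableAt ℝ c x) (hv : DifferentiableAt ℝ v x) :
    divergence (fun y => c y • v y) x = c x * divergence v x + fderiv ℝ c x (v x) := by
  have h : fderiv ℝ c x (v x) = ∑ i, fderiv ℝ c x (EuclideanSpace.single i 1) * v x i := by
    conv_lhs => rw [← sum_apply_smul_single (v x)]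
    simp [mul_comm]
  rw [h]
  simp only [divergence, partialDeriv, fderiv_fun_smul hc hv, Finset.mul_sum,
    ← Finset.sum_add_distrib]
  simp

theorem continuousAt_divergence {v : EuclideanSpace ℝ (Fin D) → EuclideanSpace ℝ (Fin D)}
    {x : EuclideanSpace ℝ (Fin D)} (hv : ContDiffAt ℝ 1 v x) : ContinuousAt (divergence v) x := by
  have h := hv.continuousAt_fderiv_of_one
  refine tendsto_finsetSum _ fun i _ => ?_
  exact (EuclideanSpace.proj (𝕜 := ℝ) i).continuous.continuousAt.tendsto.comp
    (h.clm_apply (continuousAt_const (y := EuclideanSpace.single i (1 : ℝ)))).tendsto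

/-- The divergence of a compactly supported `C¹` vector field has vanishing integral. -/
theorem integral_divergence_eq_zero {v : EuclideanSpace ℝ (Fin D) → EuclideanSpace ℝ (Fin D)}
    (hv : ContDiff ℝ 1 v) (hc : HasCompactSupport v) : ∫ x, divergence v x = 0 := by
  have hcoord : ∀ i, ContDiff ℝ 1 fun x => v x i := fun i =>
    (EuclideanSpace.proj (𝕜 := ℝ) i).contDiff.comp hv
  have hcc : ∀ i, HasCompactSupport fun x => v x i := fun i =>
    hc.comp_left (g := fun y : EuclideanSpace ℝ (Fin D) => y i) rfl
  have hd : ∀ i x, partialDeriv i i v x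
      = fderiv ℝ (fun y => v y i) x (EuclideanSpace.single i 1) := by
    intro i x
    have := ((EuclideanSpace.proj (𝕜 := ℝ) i).hasFDerivAt.comp x
      (hv.differentiable (by norm_num) x).hasFDerivAt).fderiv
    have h2 : (fun y => v y i) = (EuclideanSpace.proj (𝕜 := ℝ) i) ∘ v := rfl
    rw [h2, this]; rfl
  simp only [divergence, hd]
  rw [integral_finsetSum]
  · exact Finset.sum_eq_zero fun i _ => integral_fderiv_apply_eq_zero _ (hcoord i) (hcc i) _
  · intro i _
    exact (((hcoord i).continuous_fderiv (by norm_num)).clm_apply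
      continuous_const).integrable_of_hasCompactSupport ((hcc i).fderiv_apply (𝕜 := ℝ) _)

/-- Zero-flux divergence theorem, localised by a cutoff `ζ` supported in the open set `Ω`. -/
theorem setIntegral_cutoff_eq_zero {Ω : Set (EuclideanSpace ℝ (Fin D))} (hΩ : IsOpen Ω)
    {ζ θ : EuclideanSpace ℝ (Fin D) → ℝ}
    {v : EuclideanSpace ℝ (Fin D) → EuclideanSpace ℝ (Fin D)}
    (hζ : ContDiff ℝ 1 ζ) (hζc : HasCompactSupport ζ) (hζΩ : tsupport ζ ⊆ Ω)
    (hθ : ∀ x ∈ Ω, ContDiffAt ℝ 1 θ x) (hv : ∀ x ∈ Ω, ContDiffAt ℝ 1 v x) :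
    ∫ x in Ω, (ζ x * (θ x * divergence v x + fderiv ℝ θ x (v x)) + θ x * fderiv ℝ ζ x (v x))
      = 0 := by
  -- Extended by zero, `ζ θ v` is `C¹` on the whole space, although `θ` and `v` are controlled only
  -- in `Ω`.
  set F : EuclideanSpace ℝ (Fin D) → EuclideanSpace ℝ (Fin D) := fun x => (ζ x * θ x) • v x
  have hz : ∀ x, x ∉ tsupport ζ → F =ᶠ[𝓝 x] 0 := by
    intro x hx
    filter_upwards [notMem_tsupport_iff_eventuallyEq.1 hx] with y hy
    simp [F, hy]
  have hF : ContDiff ℝ 1 F := by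
    rw [contDiff_iff_contDiffAt]
    intro x
    by_cases hx : x ∈ tsupport ζ
    · exact (hζ.contDiffAt.mul (hθ x (hζΩ hx))).smul (hv x (hζΩ hx))
    · exact (contDiffAt_const (c := (0 : EuclideanSpace ℝ (Fin D)))).congr_of_eventuallyEq (hz x hx)
  have hFc : HasCompactSupport F := by
    refine hζc.mono ?_
    intro x hx
    simp only [Function.mem_support, F] at hx ⊢
    intro h
    simp [h] at hx
  rw [← integral_divergence_eq_zero hF hFc,
    ← setIntegral_eq_integral_of_forall_compl_eq_zero (s := Ω) (f := divergence F)]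
  · refine setIntegral_congr_fun hΩ.measurableSet fun x hx => ?_
    have h1 := hζ.differentiable (by norm_num) x
    have h2 := (hθ x hx).differentiableAt_of_one
    simp only [F]
    rw [divergence_smul (h1.fun_mul h2) (hv x hx).differentiableAt_of_one, fderiv_fun_mul h1 h2]
    simp
    ring
  · intro x hx
    rw [divergence_congr (hz x fun h => hx (hζΩ h))]
    simp [divergence, partialDeriv]

end GePUPE

/-! ### The zero-flux divergence theorem near a boundary point. -/

namespace GePUPE

open Filter

theorem deriv_smoothTransition_nonneg (s : ℝ) : 0 ≤ deriv Real.smoothTransition s :=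
  Real.smoothTransition.monotone.deriv_nonneg

/-- Locates the boundary layer: at `s = -nρ - 1` it confines `nρ` to `[-2, -1]`. -/
theorem mem_Icc_of_deriv_smoothTransition_ne_zero {s : ℝ}
    (hs : deriv Real.smoothTransition s ≠ 0) : s ∈ Icc (0 : ℝ) 1 := by
  by_contra h
  apply hs
  rw [mem_Icc, not_and_or, not_le, not_le] at h
  rcases h with h | h
  · have : Real.smoothTransition =ᶠ[𝓝 s] fun _ => 0 := by
      filter_upwards [Iio_mem_nhds h] with y hy
      exact Real.smoothTransition.zero_of_nonpos (le_of_lt hy)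
    rw [this.deriv_eq, deriv_const]
  · have : Real.smoothTransition =ᶠ[𝓝 s] fun _ => 1 := by
      filter_upwards [Ioi_mem_nhds h] with y hy
      exact Real.smoothTransition.one_of_one_le (le_of_lt hy)
    rw [this.deriv_eq, deriv_const]

variable {D : ℕ}

theorem integrableOn_of_continuousOn_of_bounded {Ω : Set (EuclideanSpace ℝ (Fin D))}
    (hΩ : IsOpen Ω) (hb : Bornology.IsBounded Ω) {f : EuclideanSpace ℝ (Fin D) → ℝ}
    (hf : ContinuousOn f Ω) {C : ℝ} (hC : ∀ x ∈ Ω, |f x| ≤ C) : IntegrableOn f Ω := by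
  have hconst : IntegrableOn (fun _ => C) Ω :=
    integrableOn_const hb.measure_lt_top.ne
  exact hconst.mono' (hf.aestronglyMeasurable hΩ.measurableSet)
    ((ae_restrict_iff' hΩ.measurableSet).2 (ae_of_all _ hC))

theorem integrableOn_of_continuousOn_closure {Ω : Set (EuclideanSpace ℝ (Fin D))}
    (hb : Bornology.IsBounded Ω) {f : EuclideanSpace ℝ (Fin D) → ℝ}
    (hf : ContinuousOn f (closure Ω)) : IntegrableOn f Ω :=
  (hf.integrableOn_compact hb.isCompact_closure).mono_set subset_closure

/-- A field `v` of class `C¹` up to the boundary of the bounded open set `Ω`, and a bounded `C¹`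
scalar field `θ` in `Ω` whose derivative along `v` is bounded. -/
structure IsFluxPair (Ω : Set (EuclideanSpace ℝ (Fin D)))
    (v : EuclideanSpace ℝ (Fin D) → EuclideanSpace ℝ (Fin D))
    (θ : EuclideanSpace ℝ (Fin D) → ℝ) : Prop where
  isOpen : IsOpen Ω
  isBounded : Bornology.IsBounded Ω
  contDiffAt_v : ∀ x ∈ closure Ω, ContDiffAt ℝ 1 v x
  contDiffAt_θ : ∀ x ∈ Ω, ContDiffAt ℝ 1 θ x
  bounded_θ : ∃ M, ∀ x ∈ Ω, |θ x| ≤ M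
  bounded_fderiv : ∃ M, ∀ x ∈ Ω, |fderiv ℝ θ x (v x)| ≤ M

/-- The divergence of the field `η θ v`. -/
noncomputable def fluxIntegrand (v : EuclideanSpace ℝ (Fin D) → EuclideanSpace ℝ (Fin D))
    (θ η : EuclideanSpace ℝ (Fin D) → ℝ) (x : EuclideanSpace ℝ (Fin D)) : ℝ :=
  η x * (θ x * divergence v x + fderiv ℝ θ x (v x)) + θ x * fderiv ℝ η x (v x)

namespace IsFluxPair

variable {Ω : Set (EuclideanSpace ℝ (Fin D))}
  {v : EuclideanSpace ℝ (Fin D) → EuclideanSpace ℝ (Fin D)} {θ : EuclideanSpace ℝ (Fin D) → ℝ}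

theorem continuousAt_fluxIntegrand (h : IsFluxPair Ω v θ) {η : EuclideanSpace ℝ (Fin D) → ℝ}
    (hη : ContDiff ℝ 1 η) {x : EuclideanSpace ℝ (Fin D)} (hx : x ∈ Ω) :
    ContinuousAt (fluxIntegrand v θ η) x := by
  have hv := h.contDiffAt_v x (subset_closure hx)
  have hθ := h.contDiffAt_θ x hx
  have h1 := hη.continuous.continuousAt (x := x)
  have h2 := (hη.continuous_fderiv (by norm_num)).continuousAt (x := x)
  exact (h1.mul ((hθ.continuousAt.mul (continuousAt_divergence hv)).add
    (hθ.continuousAt_fderiv_of_one.clm_apply hv.continuousAt))).add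
    (hθ.continuousAt.mul (h2.clm_apply hv.continuousAt))

/-- `θ` need not extend continuously to the boundary, so integrability comes from bounds in `Ω`;
only `v` and `η` are estimated by compactness of the closure. -/
theorem integrableOn_fluxIntegrand (h : IsFluxPair Ω v θ) {η : EuclideanSpace ℝ (Fin D) → ℝ}
    (hη : ContDiff ℝ 1 η) : IntegrableOn (fluxIntegrand v θ η) Ω := by
  have hK := h.isBounded.isCompact_closure
  obtain ⟨A, hA⟩ := h.bounded_θ
  obtain ⟨B, hB⟩ := h.bounded_fderiv
  obtain ⟨C, hC⟩ := hK.exists_bound_of_continuousOn (f := divergence v)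
    fun x hx => (continuousAt_divergence (h.contDiffAt_v x hx)).continuousWithinAt
  obtain ⟨R, hR⟩ := hK.exists_bound_of_continuousOn hη.continuous.continuousOn
  obtain ⟨S, hS⟩ := hK.exists_bound_of_continuousOn (f := fun x => fderiv ℝ η x (v x))
    fun x hx => ((hη.continuous_fderiv (by norm_num)).continuousAt.clm_apply
      (h.contDiffAt_v x hx).continuousAt).continuousWithinAt
  refine integrableOn_of_continuousOn_of_bounded h.isOpen h.isBounded (C := R * (A * C + B) + A * S)
    (fun x hx => (h.continuousAt_fluxIntegrand hη hx).continuousWithinAt) fun x hx => ?_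
  have hx' := subset_closure hx
  have a1 := hA x hx
  have a2 := hB x hx
  have a3 := hC x hx'
  have a4 := hR x hx'
  have a5 := hS x hx'
  rw [Real.norm_eq_abs] at a3 a4 a5
  have hA0 : 0 ≤ A := (abs_nonneg _).trans a1
  have hR0 : 0 ≤ R := (abs_nonneg _).trans a4
  unfold fluxIntegrand
  refine (abs_add_le _ _).trans (add_le_add ?_ ?_)
  · rw [abs_mul]
    refine mul_le_mul a4 ((abs_add_le _ _).trans (add_le_add ?_ a2)) (abs_nonneg _) hR0
    rw [abs_mul]
    exact mul_le_mul a1 a3 (abs_nonneg _) hA0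
  · rw [abs_mul]
    exact mul_le_mul a1 a5 (abs_nonneg _) hA0

theorem setIntegral_eq_zero_of_tsupport_subset (h : IsFluxPair Ω v θ)
    {η : EuclideanSpace ℝ (Fin D) → ℝ} (hη : ContDiff ℝ 1 η) (hηc : HasCompactSupport η)
    (hηΩ : tsupport η ⊆ Ω) : ∫ x in Ω, fluxIntegrand v θ η x = 0 :=
  setIntegral_cutoff_eq_zero h.isOpen hη hηc hηΩ h.contDiffAt_θ
    fun x hx => h.contDiffAt_v x (subset_closure hx)

/-- Zero-flux divergence theorem, localised near a boundary point where `Ω = {ρ < 0}`. -/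
theorem setIntegral_eq_zero_of_definingFunction (h : IsFluxPair Ω v θ)
    {U : Set (EuclideanSpace ℝ (Fin D))} {ρ : EuclideanSpace ℝ (Fin D) → ℝ}
    (hρ : ∀ x ∈ U, ContDiffAt ℝ 1 ρ x) (hΩU : ∀ x ∈ U, x ∈ Ω ↔ ρ x < 0)
    {e : EuclideanSpace ℝ (Fin D)} {c : ℝ} (hc : 0 < c) (he : ∀ x ∈ U, c ≤ fderiv ℝ ρ x e)
    (hvU : ∀ x ∈ U, ContinuousAt v x) (hn : ∀ x ∈ U, ρ x = 0 → fderiv ℝ ρ x (v x) = 0)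
    {η : EuclideanSpace ℝ (Fin D) → ℝ} (hη : ContDiff ℝ 1 η) (hηc : HasCompactSupport η)
    (hηU : tsupport η ⊆ U) (hη0 : ∀ x, 0 ≤ η x) : ∫ x in Ω, fluxIntegrand v θ η x = 0 := by
  obtain ⟨M, hM⟩ := h.bounded_θ
  -- For `n > 0`, `σ n` is `0` where `ρ ≥ -1/n` and `1` where `ρ ≤ -2/n`; the shift by `1` keeps the
  -- support of `η σ` off the boundary. The weight `k n` is the density of the layer: `∇(η σ) = σ ∇η
  -- - k ∇ρ`.
  set σ : ℕ → EuclideanSpace ℝ (Fin D) → ℝ :=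
    fun n x => Real.smoothTransition (-(n * ρ x) - 1) with hσ
  set k : ℕ → EuclideanSpace ℝ (Fin D) → ℝ :=
    fun n x => η x * (deriv Real.smoothTransition (-(n * ρ x) - 1) * n) with hk
  set ζ : ℕ → EuclideanSpace ℝ (Fin D) → ℝ := fun n x => η x * σ n x with hζ
  have hσ0 : ∀ n x, 0 ≤ σ n x := fun n x => Real.smoothTransition.nonneg _
  have hσ1 : ∀ n x, σ n x ≤ 1 := fun n x => Real.smoothTransition.le_one _
  have hk0 : ∀ n x, 0 ≤ k n x := fun n x =>
    mul_nonneg (hη0 x) (mul_nonneg (deriv_smoothTransition_nonneg _) n.cast_nonneg)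
  have hoff : ∀ x, x ∉ tsupport η → η =ᶠ[𝓝 x] 0 := fun x hx => notMem_tsupport_iff_eventuallyEq.1 hx
  have hdoff : ∀ x, x ∉ tsupport η → fderiv ℝ η x = 0 := by
    intro x hx
    rw [(hoff x hx).fderiv_eq]
    simp
  have hσd : ∀ n, ∀ x ∈ U, ContDiffAt ℝ 1 (σ n) x := fun n x hx =>
    Real.smoothTransition.contDiffAt.comp x
      (((contDiffAt_const.mul (hρ x hx)).neg).sub contDiffAt_const)
  have hζoff : ∀ n x, x ∉ tsupport η → ζ n =ᶠ[𝓝 x] 0 := by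
    intro n x hx
    filter_upwards [hoff x hx] with y hy
    simp [hζ, hy]
  have hζd : ∀ n, ContDiff ℝ 1 (ζ n) := by
    intro n
    rw [contDiff_iff_contDiffAt]
    intro x
    by_cases hx : x ∈ tsupport η
    · exact hη.contDiffAt.mul (hσd n x (hηU hx))
    · exact (contDiffAt_const (c := (0 : ℝ))).congr_of_eventuallyEq (hζoff n x hx)
  have hζc : ∀ n, HasCompactSupport (ζ n) := fun n => hηc.mul_right
  have hζs : ∀ n, tsupport (ζ n) ⊆ tsupport η := fun n => tsupport_mul_subset_left
  have hζΩ : ∀ n, tsupport (ζ n) ⊆ Ω := by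
    intro n x hx
    have hxU := hηU (hζs n hx)
    rw [hΩU x hxU]
    by_contra hneg
    refine notMem_tsupport_iff_eventuallyEq.2 ?_ hx
    have hcont : ContinuousAt (fun y => -(n * ρ y) - 1) x :=
      ((continuousAt_const.mul (hρ x hxU).continuousAt).neg).sub continuousAt_const
    have hlt : -(n * ρ x) - 1 < 0 := by
      have := mul_nonneg (n.cast_nonneg (α := ℝ)) (not_lt.1 hneg)
      linarith
    filter_upwards [hcont.eventually_lt continuousAt_const hlt] with y hy
    simp [hζ, hσ, Real.smoothTransition.zero_of_nonpos hy.le]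
  have hζ' : ∀ n x a, fderiv ℝ (ζ n) x a = σ n x * fderiv ℝ η x a - k n x * fderiv ℝ ρ x a := by
    intro n x a
    by_cases hx : x ∈ tsupport η
    · have hxU := hηU hx
      have hρd := (hρ x hxU).differentiableAt_of_one.hasFDerivAt
      have h1 : HasFDerivAt (σ n) (deriv Real.smoothTransition (-(n * ρ x) - 1) •
          (-((n : ℝ) • fderiv ℝ ρ x))) x := by
        exact ((Real.smoothTransition.contDiffAt
          (n := 1)).differentiableAt_of_one.hasDerivAt (x := -(n * ρ x) - 1)).comp_hasFDerivAt
          (f := fun y => -(n * ρ y) - 1) x (((hρd.const_mul (n : ℝ)).fun_neg).sub_const 1)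
      have h2 := ((hη.differentiable (by norm_num) x).hasFDerivAt.mul h1).fderiv
      have h3 : fderiv ℝ (ζ n) x = _ := h2
      rw [h3]
      simp [hk]
      ring
    · rw [(hζoff n x hx).fderiv_eq, hdoff x hx]
      have : η x = 0 := (hoff x hx).self_of_nhds
      simp [hk, this]
  -- The total mass of the boundary layer is controlled.
  have hint1 : ∀ n, Integrable fun x => σ n x * fderiv ℝ η x e := by
    intro n
    have hc1 : Continuous fun x => σ n x * fderiv ℝ η x e := by
      rw [continuous_iff_continuousAt]
      intro x
      by_cases hx : x ∈ tsupport η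
      · exact (hσd n x (hηU hx)).continuousAt.mul
          ((hη.continuous_fderiv (by norm_num)).continuousAt.clm_apply continuousAt_const)
      · have : (fun x => σ n x * fderiv ℝ η x e) =ᶠ[𝓝 x] fun _ => 0 := by
          filter_upwards [(isClosed_tsupport η).isOpen_compl.mem_nhds hx] with y hy
          simp [hdoff y hy]
        exact continuousAt_const.congr this.symm
    exact hc1.integrable_of_hasCompactSupport (hηc.fderiv_apply (𝕜 := ℝ) e).mul_left
  have hint2 : ∀ n, Integrable fun x => fderiv ℝ (ζ n) x e := fun n =>
    (((hζd n).continuous_fderiv (by norm_num)).clm_apply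
      continuous_const).integrable_of_hasCompactSupport ((hζc n).fderiv_apply (𝕜 := ℝ) e)
  have hint0 : Integrable fun x => |fderiv ℝ η x e| :=
    ((((hη).continuous_fderiv (by norm_num)).clm_apply
      continuous_const).integrable_of_hasCompactSupport (hηc.fderiv_apply (𝕜 := ℝ) e)).abs
  have hkeq : ∀ n, (fun x => k n x * fderiv ℝ ρ x e)
      = fun x => σ n x * fderiv ℝ η x e - fderiv ℝ (ζ n) x e := by
    intro n; ext x; rw [hζ']; ring
  have hint3 : ∀ n, Integrable fun x => k n x * fderiv ℝ ρ x e := fun n => by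
    rw [hkeq]; exact (hint1 n).sub (hint2 n)
  -- Since `∂ₑ(η σ)` has zero integral, the mass of the layer equals `∫ σ ∂ₑη`, bounded
  -- independently of `n` even though `k n` carries a factor `n`.
  have hmass : ∀ n, ∫ x, k n x * fderiv ℝ ρ x e ≤ ∫ x, |fderiv ℝ η x e| := by
    intro n
    rw [hkeq, integral_sub (hint1 n) (hint2 n),
      integral_fderiv_apply_eq_zero _ (hζd n) (hζc n), sub_zero]
    refine integral_mono (hint1 n) hint0 fun x => (le_abs_self _).trans ?_
    rw [abs_mul, abs_of_nonneg (hσ0 n x)]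
    exact mul_le_of_le_one_left (abs_nonneg _) (hσ1 n x)
  have hck : ∀ n x, c * k n x ≤ k n x * fderiv ℝ ρ x e := by
    intro n x
    by_cases hx : x ∈ tsupport η
    · rw [mul_comm]; exact mul_le_mul_of_nonneg_left (he x (hηU hx)) (hk0 n x)
    · have : η x = 0 := (hoff x hx).self_of_nhds
      simp [hk, this]
  set C : ℝ := ∫ x, |fderiv ℝ η x e| with hC
  have hC0 : 0 ≤ C := integral_nonneg fun x => abs_nonneg _
  -- In the boundary layer the normal component is small.
  have hsmall : ∀ δ > 0, ∃ N : ℕ, ∀ n ≥ N, ∀ x, k n x * |fderiv ℝ ρ x (v x)| ≤ k n x * δ := by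
    intro δ hδ
    have hfc : ContinuousOn (fun x => |fderiv ℝ ρ x (v x)|) (tsupport η) := fun x hx =>
      ((hρ x (hηU hx)).continuousAt_fderiv_of_one.clm_apply
        (hvU x (hηU hx))).abs.continuousWithinAt
    -- The points of the support where `|dρ(v)| ≥ δ` form a compact set that misses `{ρ = 0}`, so
    -- `|ρ| ≥ m > 0` on it. The layer lies in `|ρ| ≤ 2/n` and avoids this set once `n > 2/m`.
    have hK : IsCompact (tsupport η ∩ (fun x => |fderiv ℝ ρ x (v x)|) ⁻¹' Ici δ) :=
      hηc.isCompact.of_isClosed_subset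
        (hfc.preimage_isClosed_of_isClosed (isClosed_tsupport η) isClosed_Ici) inter_subset_left
    obtain ⟨m, hm, hmK⟩ : ∃ m > 0, ∀ x ∈ tsupport η ∩ (fun x => |fderiv ℝ ρ x (v x)|) ⁻¹' Ici δ,
        m ≤ |ρ x| := by
      rcases (tsupport η ∩ (fun x => |fderiv ℝ ρ x (v x)|) ⁻¹' Ici δ).eq_empty_or_nonempty
        with hemp | hne
      · exact ⟨1, one_pos, fun x hx => by rw [hemp] at hx; exact hx.elim⟩
      · obtain ⟨x₀, hx₀, hmin⟩ := hK.exists_isMinOn hne (f := fun x => |ρ x|) fun x hx =>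
          (hρ x (hηU hx.1)).continuousAt.abs.continuousWithinAt
        refine ⟨|ρ x₀|, abs_pos.2 fun h0 => ?_, fun x hx => hmin hx⟩
        have h2 := hx₀.2
        rw [mem_preimage, hn x₀ (hηU hx₀.1) h0, abs_zero, mem_Ici] at h2
        linarith
    obtain ⟨N, hN⟩ := exists_nat_gt (2 / m)
    refine ⟨N, fun n hnN x => ?_⟩
    by_cases hkx : k n x = 0
    · simp [hkx]
    refine mul_le_mul_of_nonneg_left ?_ (hk0 n x)
    by_contra hlt
    have hηx : η x ≠ 0 := fun h0 => hkx (by simp [hk, h0])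
    have hdx : deriv Real.smoothTransition (-(n * ρ x) - 1) ≠ 0 := fun h0 =>
      hkx (by simp [hk, h0])
    have hI := mem_Icc_of_deriv_smoothTransition_ne_zero hdx
    have hmx := hmK x ⟨subset_tsupport _ hηx, (not_le.1 hlt).le⟩
    have hn2 : 2 / m < n := hN.trans_le (by exact_mod_cast hnN)
    rw [div_lt_iff₀ hm] at hn2
    have : (n : ℝ) * |ρ x| ≤ 2 := by
      rw [← abs_of_nonneg (n.cast_nonneg (α := ℝ)), ← abs_mul, abs_le]
      constructor <;> linarith [hI.1, hI.2]
    have := mul_le_mul_of_nonneg_left hmx (n.cast_nonneg (α := ℝ))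
    linarith
  have hX := h.integrableOn_fluxIntegrand hη
  have hY : ∀ n, IntegrableOn (fluxIntegrand v θ (ζ n)) Ω := fun n =>
    h.integrableOn_fluxIntegrand (hζd n)
  have hXY : ∀ n x, σ n x * fluxIntegrand v θ η x - fluxIntegrand v θ (ζ n) x
      = θ x * (k n x * fderiv ℝ ρ x (v x)) := by
    intro n x
    simp only [fluxIntegrand, hζ']
    simp only [hζ]
    ring
  have hXoff : ∀ x, x ∉ tsupport η → fluxIntegrand v θ η x = 0 := by
    intro x hx
    have : η x = 0 := (hoff x hx).self_of_nhds
    simp [fluxIntegrand, hdoff x hx, this]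
  have hσX : ∀ n, AEStronglyMeasurable (fun x => σ n x * fluxIntegrand v θ η x)
      (volume.restrict Ω) := by
    intro n
    refine ContinuousOn.aestronglyMeasurable (fun x hx => ContinuousAt.continuousWithinAt ?_)
      h.isOpen.measurableSet
    by_cases hxs : x ∈ tsupport η
    · exact (hσd n x (hηU hxs)).continuousAt.mul (h.continuousAt_fluxIntegrand hη hx)
    · have : (fun x => σ n x * fluxIntegrand v θ η x) =ᶠ[𝓝 x] fun _ => 0 := by
        filter_upwards [(isClosed_tsupport η).isOpen_compl.mem_nhds hxs] with y hy
        simp [hXoff y hy]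
      exact continuousAt_const.congr this.symm
  have hbd : ∀ n x, ‖σ n x * fluxIntegrand v θ η x‖ ≤ |fluxIntegrand v θ η x| := by
    intro n x
    rw [Real.norm_eq_abs, abs_mul, abs_of_nonneg (hσ0 n x)]
    exact mul_le_of_le_one_left (abs_nonneg _) (hσ1 n x)
  have hσXi : ∀ n, IntegrableOn (fun x => σ n x * fluxIntegrand v θ η x) Ω := fun n =>
    hX.abs.mono' (hσX n) (ae_of_all _ (hbd n))
  have hlim : Tendsto (fun n => ∫ x in Ω, σ n x * fluxIntegrand v θ η x) atTop
      (𝓝 (∫ x in Ω, fluxIntegrand v θ η x)) := by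
    refine tendsto_integral_of_dominated_convergence _ hσX hX.abs
      (fun n => ae_of_all _ (hbd n)) ?_
    refine (ae_restrict_iff' h.isOpen.measurableSet).2 (ae_of_all _ fun x hx => ?_)
    by_cases hxs : x ∈ tsupport η
    · have hneg := (hΩU x (hηU hxs)).1 hx
      refine tendsto_const_nhds.congr' ?_
      obtain ⟨N, hN⟩ := exists_nat_gt (2 / (-ρ x))
      filter_upwards [eventually_ge_atTop N] with n hnN
      have : 2 / (-ρ x) < n := hN.trans_le (by exact_mod_cast hnN)
      rw [div_lt_iff₀ (by linarith)] at this
      simp only [hσ]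
      rw [Real.smoothTransition.one_of_one_le (by linarith), one_mul]
    · simp [hXoff x hxs]
  have hest : ∀ δ > 0, |∫ x in Ω, fluxIntegrand v θ η x| ≤ (|M| / c * C) * δ := by
    intro δ hδ
    obtain ⟨N, hN⟩ := hsmall δ hδ
    refine le_of_tendsto hlim.abs ?_
    filter_upwards [eventually_ge_atTop N] with n hnN
    -- The integrand with cutoff `η σ` has zero integral because its support lies in `Ω`; after
    -- subtracting it only the layer term `θ k dρ(v)` remains.
    have e1 : ∫ x in Ω, σ n x * fluxIntegrand v θ η x
        = ∫ x in Ω, (σ n x * fluxIntegrand v θ η x - fluxIntegrand v θ (ζ n) x) := by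
      rw [integral_sub (hσXi n) (hY n),
        h.setIntegral_eq_zero_of_tsupport_subset (hζd n) (hζc n) (hζΩ n), sub_zero]
    rw [e1, ← Real.norm_eq_abs]
    calc _ ≤ ∫ x in Ω, (|M| / c * δ) * (k n x * fderiv ℝ ρ x e) := by
          refine norm_integral_le_of_norm_le ((hint3 n).const_mul _).integrableOn ?_
          refine (ae_restrict_iff' h.isOpen.measurableSet).2 (ae_of_all _ fun x hx => ?_)
          rw [hXY, Real.norm_eq_abs, abs_mul, abs_mul, abs_of_nonneg (hk0 n x)]
          have a1 : |θ x| ≤ |M| := (hM x hx).trans (le_abs_self M)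
          have a2 := hN n hnN x
          calc |θ x| * (k n x * |fderiv ℝ ρ x (v x)|) ≤ |M| * (k n x * δ) :=
                mul_le_mul a1 a2 (mul_nonneg (hk0 n x) (abs_nonneg _)) (abs_nonneg _)
            _ = (|M| / c * δ) * (c * k n x) := by field_simp
            _ ≤ _ := mul_le_mul_of_nonneg_left (hck n x) (by positivity)
      _ ≤ ∫ x, (|M| / c * δ) * (k n x * fderiv ℝ ρ x e) := by
          refine setIntegral_le_integral ((hint3 n).const_mul _) (ae_of_all _ fun x => ?_)
          have : 0 ≤ c * k n x := mul_nonneg hc.le (hk0 n x)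
          exact mul_nonneg (by positivity) (this.trans (hck n x))
      _ ≤ (|M| / c * δ) * C := by
          rw [integral_const_mul]
          exact mul_le_mul_of_nonneg_left (hmass n) (by positivity)
      _ = _ := by ring
  refine abs_nonpos_iff.1 (le_of_forall_pos_le_add fun ε hε => ?_)
  have hA : 0 ≤ |M| / c * C := by positivity
  -- Adding `1` to the constant keeps the divisor positive when the constant is `0`.
  refine (hest (ε / (|M| / c * C + 1)) (by positivity)).trans ?_
  rw [zero_add, mul_div_assoc', div_le_iff₀ (by positivity)]
  nlinarith

end IsFluxPair

end GePUPE

/-! ### The global zero-flux theorem and orthogonality to gradients. -/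

namespace GePUPE

open Filter

variable {D : ℕ}

section Gradient

variable {f : EuclideanSpace ℝ (Fin D) → ℝ} {x : EuclideanSpace ℝ (Fin D)}

theorem fderiv_apply_eq_inner_gradient (hf : DifferentiableAt ℝ f x)
    (y : EuclideanSpace ℝ (Fin D)) : fderiv ℝ f x y = ⟪∇ f x, y⟫ := by
  rw [hf.hasGradientAt.hasFDerivAt.fderiv]
  simp

/-- The scalar potentials come with a pointwise gradient only; continuity of that gradient supplies
the `C¹` regularity needed for a flux pair. -/
theorem contDiffAt_of_hasGradientAt {Ω : Set (EuclideanSpace ℝ (Fin D))} (hΩ : IsOpen Ω)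
    {G : EuclideanSpace ℝ (Fin D) → EuclideanSpace ℝ (Fin D)}
    (hf : ∀ y ∈ Ω, HasGradientAt f (G y) y) (hG : ∀ y ∈ Ω, ContinuousAt G y) (hx : x ∈ Ω) :
    ContDiffAt ℝ 1 f x := by
  have h : ContDiffOn ℝ 1 f Ω := by
    rw [show (1 : WithTop ℕ∞) = 0 + 1 by norm_num, contDiffOn_succ_iff_fderiv_of_isOpen hΩ]
    refine ⟨fun y hy => (hf y hy).differentiableAt.differentiableWithinAt, by simp, ?_⟩
    rw [contDiffOn_zero]
    intro y hy
    have h1 : ContinuousWithinAt (fun z => InnerProductSpace.toDual ℝ _ (G z)) Ω y :=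
      ((InnerProductSpace.toDual ℝ
        (EuclideanSpace ℝ (Fin D))).continuous.continuousAt.comp (hG y hy)).continuousWithinAt
    exact h1.congr (fun z hz => (hf z hz).hasFDerivAt.fderiv) (hf y hy).hasFDerivAt.fderiv
  exact h.contDiffAt (hΩ.mem_nhds hx)

end Gradient

namespace IsFluxPair

variable {Ω : Set (EuclideanSpace ℝ (Fin D))}
  {v : EuclideanSpace ℝ (Fin D) → EuclideanSpace ℝ (Fin D)} {θ : EuclideanSpace ℝ (Fin D) → ℝ}

/-- Every point of the closure has a neighbourhood in which the zero-flux identity holds for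
all nonnegative cutoffs. -/
theorem exists_isOpen_setIntegral_eq_zero (h : IsFluxPair Ω v θ) (hΩ : IsC1Domain Ω)
    (hn : ∀ x ∈ frontier Ω, ∀ n, IsUnitOuterNormal Ω x n → ⟪v x, n⟫ = 0)
    {p : EuclideanSpace ℝ (Fin D)} (hp : p ∈ closure Ω) :
    ∃ U, IsOpen U ∧ p ∈ U ∧ ∀ η : EuclideanSpace ℝ (Fin D) → ℝ, ContDiff ℝ 1 η →
      HasCompactSupport η → tsupport η ⊆ U → (∀ x, 0 ≤ η x) →
      ∫ x in Ω, fluxIntegrand v θ η x = 0 := by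
  by_cases hpΩ : p ∈ Ω
  · exact ⟨Ω, h.isOpen, hpΩ, fun η h1 h2 h3 _ => h.setIntegral_eq_zero_of_tsupport_subset h1 h2 h3⟩
  have hpf : p ∈ frontier Ω := by
    rw [h.isOpen.frontier_eq]; exact ⟨hp, hpΩ⟩
  obtain ⟨ρ, hρ⟩ := hΩ.exists_definingFunction p hpf
  -- The gradient at `p` is a direction transversal to the boundary; by continuity `∂ₑρ` keeps at
  -- least half its value nearby.
  set e := ∇ ρ p with he
  have hepos : 0 < fderiv ℝ ρ p e := by
    rw [fderiv_apply_eq_inner_gradient hρ.contDiffAt.differentiableAt_of_one, ← he,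
      real_inner_self_eq_norm_sq]
    have := norm_pos_iff.2 hρ.gradient_ne_zero
    positivity
  set c := fderiv ℝ ρ p e / 2 with hc
  have hc0 : 0 < c := by positivity
  have hev : ∀ᶠ x in 𝓝 p, ContDiffAt ℝ 1 ρ x ∧ (x ∈ Ω ↔ ρ x < 0) ∧ c < fderiv ℝ ρ x e ∧
      ContDiffAt ℝ 1 v x := by
    refine (hρ.contDiffAt.eventually (by simp)).and (hρ.mem_iff.and (Eventually.and ?_
      ((h.contDiffAt_v p hp).eventually (by simp))))
    exact continuousAt_const.eventually_lt
      (hρ.contDiffAt.continuousAt_fderiv_of_one.clm_apply continuousAt_const)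
      (by rw [hc]; linarith)
  obtain ⟨U, hU, hUo, hpU⟩ := eventually_nhds_iff.1 hev
  refine ⟨U, hUo, hpU, fun η h1 h2 h3 h4 => h.setIntegral_eq_zero_of_definingFunction
    (fun x hx => (hU x hx).1) (fun x hx => (hU x hx).2.1) hc0 (fun x hx => (hU x hx).2.2.1.le)
    (fun x hx => (hU x hx).2.2.2.continuousAt) (fun x hx hx0 => ?_) h1 h2 h3 h4⟩
  obtain ⟨b1, b2, b3, b4⟩ := hU x hx
  have hgr : ∇ ρ x ≠ 0 := by
    intro h0
    rw [fderiv_apply_eq_inner_gradient b1.differentiableAt_of_one, h0, inner_zero_left] at b3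
    linarith
  -- Away from the closure `ρ ≥ 0`, so a zero of `ρ` there would be a local minimum, against `∂ₑρ >
  -- 0`.
  have hxcl : x ∈ closure Ω := by
    by_contra hxn
    have hmin : IsLocalMin ρ x := by
      filter_upwards [isClosed_closure.isOpen_compl.mem_nhds hxn, hUo.mem_nhds hx] with y hy hyU
      rw [hx0]
      by_contra hlt
      exact hy (subset_closure ((hU y hyU).2.1.2 (not_le.1 hlt)))
    rw [hmin.fderiv_eq_zero] at b3
    simp only [zero_apply] at b3
    linarith
  have hxf : x ∈ frontier Ω := by
    rw [h.isOpen.frontier_eq]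
    exact ⟨hxcl, fun hxΩ => by have := b2.1 hxΩ; linarith⟩
  -- The same `ρ` defines `Ω` at every zero of `ρ` in `U`, so its normalised gradient is an
  -- admissible normal there.
  have hd : IsDefiningFunctionAt Ω x ρ :=
    ⟨b1, hx0, hgr, by filter_upwards [hUo.mem_nhds hx] with y hy using (hU y hy).2.1⟩
  have := hn x hxf _ ⟨ρ, hd, rfl⟩
  rw [inner_smul_right, mul_eq_zero] at this
  rcases this with h0 | h0
  · exact absurd h0 (inv_ne_zero (norm_ne_zero_iff.2 hgr))
  · rw [fderiv_apply_eq_inner_gradient b1.differentiableAt_of_one, real_inner_comm, h0]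

theorem fluxIntegrand_sub {η η' : EuclideanSpace ℝ (Fin D) → ℝ} (hη : ContDiff ℝ 1 η)
    (hη' : ContDiff ℝ 1 η') (x : EuclideanSpace ℝ (Fin D)) :
    fluxIntegrand v θ (fun y => η y - η' y) x
      = fluxIntegrand v θ η x - fluxIntegrand v θ η' x := by
  simp only [fluxIntegrand, fderiv_fun_sub (hη.differentiable (by norm_num) x)
    (hη'.differentiable (by norm_num) x), sub_apply]
  ring

/-- The zero-flux divergence theorem in a `C¹` domain: if `v · n = 0` on the boundary, then
`∫_Ω ∇ · (θ v) = 0`. The scalar field `θ` need not be defined on the boundary. -/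
theorem setIntegral_eq_zero (h : IsFluxPair Ω v θ) (hΩ : IsC1Domain Ω)
    (hn : ∀ x ∈ frontier Ω, ∀ n, IsUnitOuterNormal Ω x n → ⟪v x, n⟫ = 0) :
    ∫ x in Ω, (θ x * divergence v x + fderiv ℝ θ x (v x)) = 0 := by
  have hloc : ∀ p ∈ closure Ω, ∃ f : EuclideanSpace ℝ (Fin D) → ℝ, ContDiff ℝ 1 f ∧
      (∀ x, f x ≤ 1) ∧ (∀ᶠ x in 𝓝 p, f x = 1) ∧ ∀ η : EuclideanSpace ℝ (Fin D) → ℝ,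
      ContDiff ℝ 1 η → (∀ x, 0 ≤ η x) → ∫ x in Ω, fluxIntegrand v θ (fun y => f y * η y) x = 0 := by
    intro p hp
    obtain ⟨U, hU, hpU, hη⟩ := h.exists_isOpen_setIntegral_eq_zero hΩ hn hp
    obtain ⟨r, hr, hrU⟩ := Metric.isOpen_iff.1 hU p hpU
    let f : ContDiffBump p := ⟨r / 4, r / 2, by positivity, by linarith⟩
    refine ⟨f, f.contDiff, fun x => f.le_one, f.eventuallyEq_one, fun η h1 h2 => hη _
      (f.contDiff.mul h1) f.hasCompactSupport.mul_right
      (tsupport_mul_subset_left.trans ?_) fun x => mul_nonneg f.nonneg (h2 x)⟩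
    rw [f.tsupport_eq]
    exact (Metric.closedBall_subset_ball (by simp only [f]; linarith)).trans hrU
  choose! f hf1 hf2 hf3 hf4 using hloc
  obtain ⟨t, ht, hcov⟩ := h.isBounded.isCompact_closure.elim_nhds_subcover
    (fun p => {x | f p x = 1}) hf3
  have hP1 : ∀ s ⊆ t, ContDiff ℝ 1 fun x => ∏ p ∈ s, (1 - f p x) := fun s hs =>
    contDiff_prod fun p hp => contDiff_const.sub (hf1 p (ht p (hs hp)))
  have hP0 : ∀ s ⊆ t, ∀ x, 0 ≤ ∏ p ∈ s, (1 - f p x) := fun s hs x =>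
    Finset.prod_nonneg fun p hp => by linarith [hf2 p (ht p (hs hp)) x]
  -- In place of a partition of unity, the factors `1 - f p` are inserted one by one. Each insertion
  -- changes the cutoff by `f a` times a nonnegative `C¹` function, which contributes zero. The full
  -- product vanishes on `Ω` because the sets `f p = 1` cover it, whereas the empty product is the
  -- cutoff `1`.
  have hind : ∀ s : Finset (EuclideanSpace ℝ (Fin D)), s ⊆ t →
      ∫ x in Ω, fluxIntegrand v θ (fun y => ∏ p ∈ s, (1 - f p y)) x
        = ∫ x in Ω, fluxIntegrand v θ (fun _ => 1) x := by
    classical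
    intro s
    induction s using Finset.induction_on with
    | empty => intro _; simp
    | insert a s ha ih =>
      intro hs
      have hs' : s ⊆ t := (Finset.subset_insert a s).trans hs
      have hat := ht a (hs (Finset.mem_insert_self a s))
      have e : (fun y => ∏ p ∈ insert a s, (1 - f p y))
          = fun y => ∏ p ∈ s, (1 - f p y) - f a y * ∏ p ∈ s, (1 - f p y) := by
        ext y; rw [Finset.prod_insert ha]; ring
      have hm := (hf1 a hat).mul (hP1 s hs')
      rw [e]
      simp_rw [fluxIntegrand_sub (hP1 s hs') hm]
      rw [integral_sub (h.integrableOn_fluxIntegrand (hP1 s hs'))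
        (h.integrableOn_fluxIntegrand hm), hf4 a hat _ (hP1 s hs') (hP0 s hs'), sub_zero, ih hs']
  have h1 := hind t subset_rfl
  have hz : ∀ x ∈ Ω, (∏ p ∈ t, (1 - f p x)) = 0 := by
    intro x hx
    obtain ⟨p, hp, hpx⟩ := mem_iUnion₂.1 (hcov (subset_closure hx))
    exact Finset.prod_eq_zero hp (by rw [mem_ofPred_eq] at hpx; rw [hpx, sub_self])
  rw [setIntegral_eq_zero_of_forall_eq_zero] at h1
  · rw [h1]; simp [fluxIntegrand]
  · intro x hx
    have he : (fun y => ∏ p ∈ t, (1 - f p y)) =ᶠ[𝓝 x] fun _ => 0 := by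
      filter_upwards [h.isOpen.mem_nhds hx] with y hy using hz y hy
    simp [fluxIntegrand, he.fderiv_eq, hz x hx]

end IsFluxPair

/-- The integral over `Ω` of the divergence of a field tangential to the boundary vanishes. -/
theorem setIntegral_divergence_eq_zero {Ω : Set (EuclideanSpace ℝ (Fin D))} (hΩ : IsC1Domain Ω)
    {v : EuclideanSpace ℝ (Fin D) → EuclideanSpace ℝ (Fin D)}
    (hv : ∀ x ∈ closure Ω, ContDiffAt ℝ 1 v x)
    (hn : ∀ x ∈ frontier Ω, ∀ n, IsUnitOuterNormal Ω x n → ⟪v x, n⟫ = 0) :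
    ∫ x in Ω, divergence v x = 0 := by
  have h : IsFluxPair Ω v fun _ => 1 := ⟨hΩ.isOpen, hΩ.isBounded, hv, fun _ _ => contDiffAt_const,
    ⟨1, by simp⟩, ⟨0, by simp⟩⟩
  simpa using h.setIntegral_eq_zero hΩ hn

/-- Truncation of an unbounded potential: `k arctan(s / k)` is bounded, while its derivative lies in
`(0, 1]` and tends to `1` as `k → ∞`. -/
theorem hasDerivAt_scaled_arctan {k : ℝ} (hk : 0 < k) (s : ℝ) :
    HasDerivAt (fun s => k * Real.arctan (s / k)) (1 / (1 + (s / k) ^ 2)) s := by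
  have h := ((Real.hasDerivAt_arctan (s / k)).comp s ((hasDerivAt_id s).div_const k)).const_mul k
  refine HasDerivAt.congr_deriv (f := fun s => k * Real.arctan (s / k)) h ?_
  field_simp

/-- Truncated orthogonality of solenoidal fields tangential to the boundary and gradients. -/
theorem setIntegral_truncated_inner_gradient_eq_zero {Ω : Set (EuclideanSpace ℝ (Fin D))}
    (hΩ : IsC1Domain Ω) {v G : EuclideanSpace ℝ (Fin D) → EuclideanSpace ℝ (Fin D)}
    (hv : ∀ x ∈ closure Ω, ContDiffAt ℝ 1 v x) (hdiv : ∀ x ∈ Ω, divergence v x = 0)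
    (hn : ∀ x ∈ frontier Ω, ∀ n, IsUnitOuterNormal Ω x n → ⟪v x, n⟫ = 0)
    (hG : ∀ x ∈ closure Ω, ContinuousAt G x) {ψ : EuclideanSpace ℝ (Fin D) → ℝ}
    (hψ : ∀ x ∈ Ω, HasGradientAt ψ (G x) x) {k : ℝ} (hk : 0 < k) :
    ∫ x in Ω, 1 / (1 + (ψ x / k) ^ 2) * ⟪v x, G x⟫ = 0 := by
  have hd : ∀ x ∈ Ω, fderiv ℝ (fun y => k * Real.arctan (ψ y / k)) x (v x)
      = 1 / (1 + (ψ x / k) ^ 2) * ⟪v x, G x⟫ := by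
    intro x hx
    have := ((hasDerivAt_scaled_arctan hk (ψ x)).comp_hasFDerivAt x
      (hψ x hx).hasFDerivAt).fderiv
    have h2 : fderiv ℝ (fun y => k * Real.arctan (ψ y / k)) x = _ := this
    rw [h2]
    simp [real_inner_comm]
  have hle : ∀ s : ℝ, |1 / (1 + s ^ 2)| ≤ 1 := by
    intro s
    rw [abs_of_nonneg (by positivity), div_le_one (by positivity)]
    nlinarith [sq_nonneg s]
  obtain ⟨C, hC⟩ := hΩ.isBounded.isCompact_closure.exists_bound_of_continuousOn
    (f := fun x => ⟪v x, G x⟫)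
    fun x hx => ((hv x hx).continuousAt.inner (𝕜 := ℝ) (hG x hx)).continuousWithinAt
  have h : IsFluxPair Ω v fun y => k * Real.arctan (ψ y / k) := by
    refine ⟨hΩ.isOpen, hΩ.isBounded, hv, fun x hx => ?_, ⟨k * (Real.pi / 2), fun x _ => ?_⟩,
      ⟨C, fun x hx => ?_⟩⟩
    · have := contDiffAt_of_hasGradientAt hΩ.isOpen hψ
        (fun y hy => hG y (subset_closure hy)) hx
      exact contDiffAt_const.mul ((this.div_const k).arctan)
    · rw [abs_mul, abs_of_pos hk]
      exact mul_le_mul_of_nonneg_left (abs_le.2 ⟨(Real.neg_pi_div_two_lt_arctan _).le,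
          (Real.arctan_lt_pi_div_two _).le⟩) hk.le
    · rw [hd x hx, abs_mul]
      exact (mul_le_of_le_one_left (abs_nonneg _) (hle _)).trans (hC x (subset_closure hx))
  rw [← h.setIntegral_eq_zero hΩ hn]
  refine setIntegral_congr_fun hΩ.isOpen.measurableSet fun x hx => ?_
  simp only [hd x hx, hdiv x hx, mul_zero, zero_add]

/-- Solenoidal fields tangential to the boundary are orthogonal to gradients. -/
theorem setIntegral_inner_gradient_eq_zero {Ω : Set (EuclideanSpace ℝ (Fin D))}
    (hΩ : IsC1Domain Ω) {v G : EuclideanSpace ℝ (Fin D) → EuclideanSpace ℝ (Fin D)}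
    (hv : ∀ x ∈ closure Ω, ContDiffAt ℝ 1 v x) (hdiv : ∀ x ∈ Ω, divergence v x = 0)
    (hn : ∀ x ∈ frontier Ω, ∀ n, IsUnitOuterNormal Ω x n → ⟪v x, n⟫ = 0)
    (hG : ∀ x ∈ closure Ω, ContinuousAt G x) {ψ : EuclideanSpace ℝ (Fin D) → ℝ}
    (hψ : ∀ x ∈ Ω, HasGradientAt ψ (G x) x) : ∫ x in Ω, ⟪v x, G x⟫ = 0 := by
  have hi : IntegrableOn (fun x => ⟪v x, G x⟫) Ω :=
    integrableOn_of_continuousOn_closure hΩ.isBounded fun x hx =>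
      ((hv x hx).continuousAt.inner (𝕜 := ℝ) (hG x hx)).continuousWithinAt
  -- The truncation level `n + 1` is always positive, and `|⟪v, G⟫|` dominates all the integrands.
  have hlim : Tendsto (fun n : ℕ => ∫ x in Ω, 1 / (1 + (ψ x / ((n : ℝ) + 1)) ^ 2) * ⟪v x, G x⟫)
      atTop (𝓝 (∫ x in Ω, ⟪v x, G x⟫)) := by
    refine tendsto_integral_of_dominated_convergence _ (fun n => ?_) hi.abs (fun n => ?_) ?_
    · refine ContinuousOn.aestronglyMeasurable (fun x hx => ?_) hΩ.isOpen.measurableSet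
      have h1 := (hψ x hx).differentiableAt.continuousAt
      have hx' := subset_closure hx
      have hp : (1 : ℝ) + (ψ x / ((n : ℝ) + 1)) ^ 2 ≠ 0 := by positivity
      exact ((continuousAt_const.div (continuousAt_const.add ((h1.div_const _).pow 2))
        hp).mul
        ((hv x hx').continuousAt.inner (𝕜 := ℝ) (hG x hx'))).continuousWithinAt
    · refine ae_of_all _ fun x => ?_
      rw [Real.norm_eq_abs, abs_mul, abs_of_nonneg (by positivity)]
      refine mul_le_of_le_one_left (abs_nonneg _) ?_
      rw [div_le_one (by positivity)]
      nlinarith [sq_nonneg (ψ x / ((n : ℝ) + 1))]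
    · refine ae_of_all _ fun x => ?_
      have h1 : Tendsto (fun n : ℕ => ψ x / ((n : ℝ) + 1)) atTop (𝓝 0) :=
        tendsto_const_nhds.div_atTop
          (tendsto_atTop_add_const_right _ _ tendsto_natCast_atTop_atTop)
      have h2 := ((tendsto_const_nhds (x := (1 : ℝ))).div ((h1.pow 2).const_add 1)
        (by norm_num)).mul_const ⟪v x, G x⟫
      simpa using h2
  have h0 : ∀ n : ℕ, ∫ x in Ω, 1 / (1 + (ψ x / ((n : ℝ) + 1)) ^ 2) * ⟪v x, G x⟫ = 0 := fun n =>
    setIntegral_truncated_inner_gradient_eq_zero hΩ hv hdiv hn hG hψ (by positivity)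
  simp_rw [h0] at hlim
  exact (tendsto_nhds_unique hlim tendsto_const_nhds)

theorem eq_zero_of_setIntegral_eq_zero {Ω : Set (EuclideanSpace ℝ (Fin D))} (hΩ : IsOpen Ω)
    {f : EuclideanSpace ℝ (Fin D) → ℝ} (hf : ∀ x ∈ Ω, ContinuousAt f x) (hf0 : ∀ x, 0 ≤ f x)
    (hi : IntegrableOn f Ω) (h : ∫ x in Ω, f x = 0) : ∀ x ∈ Ω, f x = 0 := by
  rw [setIntegral_eq_zero_iff_of_nonneg_ae (ae_of_all _ hf0) hi] at h
  have := Measure.eqOn_open_of_ae_eq h hΩ (fun x hx => (hf x hx).continuousWithinAt)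
    continuousOn_const
  exact fun x hx => this hx

/-- A solenoidal gradient tangential to the boundary vanishes. -/
theorem eq_zero_of_solenoidal_of_gradient {Ω : Set (EuclideanSpace ℝ (Fin D))}
    (hΩ : IsC1Domain Ω) {v : EuclideanSpace ℝ (Fin D) → EuclideanSpace ℝ (Fin D)}
    (hv : ∀ x ∈ closure Ω, ContDiffAt ℝ 1 v x) (hdiv : ∀ x ∈ Ω, divergence v x = 0)
    (hn : ∀ x ∈ frontier Ω, ∀ n, IsUnitOuterNormal Ω x n → ⟪v x, n⟫ = 0)
    {ψ : EuclideanSpace ℝ (Fin D) → ℝ} (hψ : ∀ x ∈ Ω, HasGradientAt ψ (v x) x) :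
    ∀ x ∈ Ω, v x = 0 := by
  have h0 := setIntegral_inner_gradient_eq_zero hΩ hv hdiv hn
    (fun x hx => (hv x hx).continuousAt) hψ
  have hc : ∀ x ∈ closure Ω, ContinuousAt (fun x => ⟪v x, v x⟫) x := fun x hx =>
    (hv x hx).continuousAt.inner (𝕜 := ℝ) (hv x hx).continuousAt
  intro x hx
  exact inner_self_eq_zero.1 (eq_zero_of_setIntegral_eq_zero hΩ.isOpen
    (fun y hy => hc y (subset_closure hy)) (fun y => real_inner_self_nonneg)
    (integrableOn_of_continuousOn_closure hΩ.isBounded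
      fun y hy => (hc y hy).continuousWithinAt) h0 x hx)

end GePUPE

/-! ### Second-order calculus and the maximum principle. -/

namespace GePUPE

open Filter

section SecondOrder

variable {D : ℕ} {F : Type*} [NormedAddCommGroup F] [NormedSpace ℝ F]

theorem laplacian_eq_sum (f : EuclideanSpace ℝ (Fin D) → F) (x : EuclideanSpace ℝ (Fin D)) :
    Δ f x = ∑ i, fderiv ℝ (fderiv ℝ f) x (EuclideanSpace.single i 1)
      (EuclideanSpace.single i 1) := by
  rw [InnerProductSpace.laplacian_eq_iteratedFDeriv_orthonormalBasis f
    (EuclideanSpace.basisFun (Fin D) ℝ)]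
  simp [iteratedFDeriv_two_apply]

/-- A positive second derivative would make `s` a local minimum as well, so `g` would be constant
near `s` and its second derivative zero. -/
theorem deriv_deriv_nonpos_of_isLocalMax {g : ℝ → ℝ} {s : ℝ} (hg : ContinuousAt g s)
    (h : IsLocalMax g s) : deriv (deriv g) s ≤ 0 := by
  by_contra hpos
  have hmin := isLocalMin_of_deriv_deriv_pos (not_le.1 hpos) h.deriv_eq_zero hg
  have hc : g =ᶠ[𝓝 s] fun _ => g s := by
    filter_upwards [h, hmin] with y h1 h2 using le_antisymm h1 h2
  have hd : deriv g =ᶠ[𝓝 s] fun _ => 0 := by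
    have := hc.deriv
    simpa using this
  rw [hd.deriv_eq, deriv_const] at hpos
  exact hpos le_rfl

theorem laplacian_nonpos_of_isLocalMax {f : EuclideanSpace ℝ (Fin D) → ℝ}
    {x : EuclideanSpace ℝ (Fin D)} (hf : ContDiffAt ℝ 2 f x) (h : IsLocalMax f x) :
    Δ f x ≤ 0 := by
  rw [laplacian_eq_sum]
  refine Finset.sum_nonpos fun i _ => ?_
  set e : EuclideanSpace ℝ (Fin D) := EuclideanSpace.single i 1
  have hline : ∀ s : ℝ, HasDerivAt (fun s : ℝ => x + s • e) e s := fun s => by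
    simpa using ((hasDerivAt_id s).smul_const e).const_add x
  have h0 : Tendsto (fun s : ℝ => x + s • e) (𝓝 0) (𝓝 x) := by
    have := (hline 0).continuousAt.tendsto
    simpa using this
  have hd1 : deriv (fun s : ℝ => f (x + s • e)) =ᶠ[𝓝 0] fun s => fderiv ℝ f (x + s • e) e := by
    have hev : ∀ᶠ y in 𝓝 x, ContDiffAt ℝ 2 f y := hf.eventually (by simp)
    filter_upwards [h0.eventually hev] with s hs
    exact ((hs.differentiableAt (by norm_num)).hasFDerivAt.comp_hasDerivAt s (hline s)).deriv
  have hd2 : deriv (deriv fun s : ℝ => f (x + s • e)) 0 = fderiv ℝ (fderiv ℝ f) x e e := by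
    rw [hd1.deriv_eq]
    have h1 : HasFDerivAt (fderiv ℝ f) (fderiv ℝ (fderiv ℝ f) x) (x + (0 : ℝ) • e) := by
      rw [zero_smul, add_zero]
      exact ((hf.fderiv_right (m := 1) (by norm_num)).differentiableAt_of_one).hasFDerivAt
    have h2 : HasDerivAt (fun s : ℝ => fderiv ℝ f (x + s • e)) (fderiv ℝ (fderiv ℝ f) x e) 0 :=
      HasFDerivAt.comp_hasDerivAt (f := fun s : ℝ => x + s • e) (0 : ℝ) h1 (hline 0)
    exact ((ContinuousLinearMap.apply ℝ ℝ e).hasFDerivAt.comp_hasDerivAt (0 : ℝ) h2).deriv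
  rw [← hd2]
  refine deriv_deriv_nonpos_of_isLocalMax ?_ ?_
  · refine ContinuousAt.comp (g := f) ?_ (hline 0).continuousAt
    simpa using hf.continuousAt
  · have : ∀ᶠ s : ℝ in 𝓝 0, f (x + s • e) ≤ f x := h0.eventually h
    filter_upwards [this] with s hs
    simpa using hs

/-- The weak maximum principle for the heat equation. -/
theorem nonpos_of_heat_equation {Ω : Set (EuclideanSpace ℝ (Fin D))} (hΩ : IsOpen Ω)
    (hb : Bornology.IsBounded Ω) {ν : ℝ} (hν : 0 ≤ ν) {a b : ℝ}
    {f : ℝ → EuclideanSpace ℝ (Fin D) → ℝ}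
    (hc : ContinuousOn (fun z : ℝ × EuclideanSpace ℝ (Fin D) => f z.1 z.2)
      (Icc a b ×ˢ closure Ω))
    (h0 : ∀ x ∈ closure Ω, f a x ≤ 0) (hbd : ∀ t ∈ Icc a b, ∀ x ∈ frontier Ω, f t x ≤ 0)
    (h2 : ∀ t ∈ Icc a b, ∀ x ∈ Ω, ContDiffAt ℝ 2 (f t) x)
    (hheat : ∀ t ∈ Icc a b, ∀ x ∈ Ω, HasDerivAt (fun s => f s x) (ν * Δ (f t) x) t) :
    ∀ t ∈ Icc a b, ∀ x ∈ closure Ω, f t x ≤ 0 := by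
  intro t₁ ht₁ x₁ hx₁
  by_contra! hpos
  have hta : 0 < t₁ - a + 1 := by linarith [ht₁.1]
  -- This choice gives `ε (t₁ - a) < f t₁ x₁`, so the penalised function `f - ε (t - a)` is still
  -- positive at `(t₁, x₁)`, hence at its maximum. The `+ 1` covers `t₁ = a`.
  set ε := f t₁ x₁ / (t₁ - a + 1) with hε
  have hε0 : 0 < ε := by positivity
  have hstart : 0 < f t₁ x₁ - ε * (t₁ - a) := by
    have : ε * (t₁ - a + 1) = f t₁ x₁ := by rw [hε]; field_simp
    linarith
  have hK : IsCompact (Icc a b ×ˢ closure Ω) := isCompact_Icc.prod hb.isCompact_closure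
  obtain ⟨⟨τ, y⟩, ⟨hτ, hy⟩, hmax⟩ := hK.exists_isMaxOn (f := fun z => f z.1 z.2 - ε * (z.1 - a))
    ⟨(t₁, x₁), ht₁, hx₁⟩ (hc.sub (by fun_prop))
  simp only at hτ hy
  have hm : ∀ t ∈ Icc a b, ∀ x ∈ closure Ω, f t x - ε * (t - a) ≤ f τ y - ε * (τ - a) :=
    fun t ht x hx => hmax (show (t, x) ∈ Icc a b ×ˢ closure Ω from ⟨ht, hx⟩)
  have hF : 0 < f τ y - ε * (τ - a) := hstart.trans_le (hm _ ht₁ _ hx₁)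
  have hfp : 0 < f τ y := by
    have := mul_nonneg hε0.le (sub_nonneg.2 hτ.1)
    linarith
  have haτ : a < τ := by
    refine lt_of_le_of_ne hτ.1 fun h => ?_
    subst h
    exact absurd (h0 y hy) (not_le.2 hfp)
  have hyΩ : y ∈ Ω := by
    by_contra hn
    exact absurd (hbd τ hτ y (by rw [hΩ.frontier_eq]; exact ⟨hy, hn⟩)) (not_le.2 hfp)
  have hlap : Δ (f τ) y ≤ 0 := by
    refine laplacian_nonpos_of_isLocalMax (h2 τ hτ y hyΩ) ?_
    filter_upwards [hΩ.mem_nhds hyΩ] with x hx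
    linarith [hm τ hτ x (subset_closure hx)]
  have hder : HasDerivAt (fun s => f s y - ε * (s - a)) (ν * Δ (f τ) y - ε) τ := by
    have := (hheat τ hτ y hyΩ).fun_sub (((hasDerivAt_id τ).sub_const a).const_mul ε)
    simpa using this
  -- The maximum may sit at the final time `b`, so only difference quotients from the left are used.
  have hge : 0 ≤ ν * Δ (f τ) y - ε := by
    have hs := (hasDerivWithinAt_iff_tendsto_slope' (s := Iio τ) (by simp)).1
      hder.hasDerivWithinAt
    refine ge_of_tendsto hs ?_
    filter_upwards [Ioo_mem_nhdsLT haτ] with s hs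
    rw [slope_def_field]
    have := hm s ⟨hs.1.le, hs.2.le.trans hτ.2⟩ y hy
    exact div_nonneg_of_nonpos (by linarith) (by linarith [hs.2])
  have := mul_nonpos_of_nonneg_of_nonpos hν hlap
  linarith

theorem partialDeriv_eq_fderiv {v : EuclideanSpace ℝ (Fin D) → EuclideanSpace ℝ (Fin D)}
    {x : EuclideanSpace ℝ (Fin D)} (hv : DifferentiableAt ℝ v x) (i j : Fin D) :
    partialDeriv i j v x = fderiv ℝ (fun y => v y i) x (EuclideanSpace.single j 1) := by
  have := ((EuclideanSpace.proj (𝕜 := ℝ) i).hasFDerivAt.comp x hv.hasFDerivAt).fderiv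
  have h2 : (fun y => v y i) = (EuclideanSpace.proj (𝕜 := ℝ) i) ∘ v := rfl
  rw [h2, this]; rfl

theorem gradient_apply (f : EuclideanSpace ℝ (Fin D) → ℝ) (x : EuclideanSpace ℝ (Fin D))
    (i : Fin D) : ∇ f x i = fderiv ℝ f x (EuclideanSpace.single i 1) := by
  have h : ⟪∇ f x, EuclideanSpace.single i (1 : ℝ)⟫
      = fderiv ℝ f x (EuclideanSpace.single i 1) := by
    rw [gradient, InnerProductSpace.toDual_symm_apply]
  rw [← h, EuclideanSpace.inner_single_right]
  simp

theorem contDiffAt_gradient {f : EuclideanSpace ℝ (Fin D) → ℝ} {x : EuclideanSpace ℝ (Fin D)}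
    (hf : ContDiffAt ℝ 2 f x) : ContDiffAt ℝ 1 (∇ f) x := by
  rw [contDiffAt_euclidean]
  intro i
  simp only [gradient_apply]
  exact (hf.fderiv_right (m := 1) (by norm_num)).clm_apply contDiffAt_const

theorem divergence_gradient {f : EuclideanSpace ℝ (Fin D) → ℝ} {x : EuclideanSpace ℝ (Fin D)}
    (hf : ContDiffAt ℝ 2 f x) : divergence (∇ f) x = Δ f x := by
  rw [laplacian_eq_sum, divergence]
  refine Finset.sum_congr rfl fun i _ => ?_
  rw [partialDeriv_eq_fderiv (contDiffAt_gradient hf).differentiableAt_of_one]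
  simp only [gradient_apply]
  have h1 := (hf.fderiv_right (m := 1) (by norm_num)).differentiableAt_of_one.hasFDerivAt
  have h2 := (h1.clm_apply (hasFDerivAt_const (EuclideanSpace.single i (1 : ℝ)) x)).fderiv
  rw [h2]
  simp

theorem contDiffAt_convection {u : EuclideanSpace ℝ (Fin D) → EuclideanSpace ℝ (Fin D)}
    {x : EuclideanSpace ℝ (Fin D)} (hu : ContDiffAt ℝ 2 u x) :
    ContDiffAt ℝ 1 (convection u) x :=
  (hu.fderiv_right (m := 1) (by norm_num)).clm_apply (hu.of_le (by norm_num))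

theorem contDiffAt_laplacian {f : EuclideanSpace ℝ (Fin D) → F}
    {x : EuclideanSpace ℝ (Fin D)} (hf : ContDiffAt ℝ 3 f x) : ContDiffAt ℝ 1 (Δ f) x := by
  have h : Δ f = fun y => ∑ i, fderiv ℝ (fderiv ℝ f) y (EuclideanSpace.single i 1)
      (EuclideanSpace.single i 1) := funext (laplacian_eq_sum f)
  rw [h]
  have h2 : ContDiffAt ℝ 1 (fderiv ℝ (fderiv ℝ f)) x :=
    (hf.fderiv_right (m := 2) (by norm_num)).fderiv_right (m := 1) (by norm_num)
  exact ContDiffAt.sum fun i _ => (h2.clm_apply contDiffAt_const).clm_apply contDiffAt_const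

/-- The divergence as a linear function of the derivative. -/
noncomputable def traceCLM (D : ℕ) :
    (EuclideanSpace ℝ (Fin D) →L[ℝ] EuclideanSpace ℝ (Fin D)) →L[ℝ] ℝ :=
  ∑ i, (EuclideanSpace.proj (𝕜 := ℝ) i).comp
    (ContinuousLinearMap.apply ℝ (EuclideanSpace ℝ (Fin D)) (EuclideanSpace.single i (1 : ℝ)))

theorem traceCLM_apply (L : EuclideanSpace ℝ (Fin D) →L[ℝ] EuclideanSpace ℝ (Fin D)) :
    traceCLM D L = ∑ i, L (EuclideanSpace.single i 1) i := by
  simp [traceCLM]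

theorem divergence_eq_traceCLM (v : EuclideanSpace ℝ (Fin D) → EuclideanSpace ℝ (Fin D)) :
    divergence v = traceCLM D ∘ fderiv ℝ v := by
  ext x
  simp [traceCLM_apply, divergence, partialDeriv]

theorem contDiffAt_divergence {v : EuclideanSpace ℝ (Fin D) → EuclideanSpace ℝ (Fin D)}
    {x : EuclideanSpace ℝ (Fin D)} (hv : ContDiffAt ℝ 3 v x) :
    ContDiffAt ℝ 2 (divergence v) x := by
  rw [divergence_eq_traceCLM]
  exact (traceCLM D).contDiff.contDiffAt.comp x (hv.fderiv_right (by norm_num))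

theorem fderiv_fderiv_comm {E : Type*} [NormedAddCommGroup E] [NormedSpace ℝ E] {f : E → F}
    {x : E} (hf : ContDiffAt ℝ 2 f x) (a b : E) :
    fderiv ℝ (fderiv ℝ f) x a b = fderiv ℝ (fderiv ℝ f) x b a :=
  hf.isSymmSndFDerivAt (by simp) a b

/-- Total symmetry of `D³v`: the last two slots commute by differentiating the symmetry of `D²v`
near `x`, the first two by symmetry of the second derivative of `Dv`. -/
theorem divergence_laplacian {v : EuclideanSpace ℝ (Fin D) → EuclideanSpace ℝ (Fin D)}
    {x : EuclideanSpace ℝ (Fin D)} (hv : ContDiffAt ℝ 3 v x) :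
    divergence (Δ v) x = Δ (divergence v) x := by
  have h1 : ContDiffAt ℝ 2 (fderiv ℝ v) x := hv.fderiv_right (by norm_num)
  have h2 : ContDiffAt ℝ 1 (fderiv ℝ (fderiv ℝ v)) x := h1.fderiv_right (by norm_num)
  have hev : ∀ᶠ y in 𝓝 x, ContDiffAt ℝ 3 v y := hv.eventually (by simp)
  have hD : ∀ a b c, fderiv ℝ (fun y => fderiv ℝ (fderiv ℝ v) y b c) x a
      = fderiv ℝ (fderiv ℝ (fderiv ℝ v)) x a b c := by
    intro a b c
    have h3 := ((h2.differentiableAt_of_one.hasFDerivAt.clm_apply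
      (hasFDerivAt_const b x)).clm_apply (hasFDerivAt_const c x)).fderiv
    rw [h3]
    simp
  have hs : ∀ a b c, fderiv ℝ (fderiv ℝ (fderiv ℝ v)) x a b c
      = fderiv ℝ (fderiv ℝ (fderiv ℝ v)) x a c b := by
    intro a b c
    rw [← hD, ← hD]
    have : (fun y => fderiv ℝ (fderiv ℝ v) y b c) =ᶠ[𝓝 x] fun y => fderiv ℝ (fderiv ℝ v) y c b := by
      filter_upwards [hev] with y hy
      exact fderiv_fderiv_comm (hy.of_le (by norm_num)) b c
    rw [this.fderiv_eq]
  have hR : Δ (divergence v) x = traceCLM D (Δ (fderiv ℝ v) x) := by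
    rw [divergence_eq_traceCLM]
    exact h1.laplacian_CLM_comp_left
  rw [hR, traceCLM_apply, divergence]
  refine Finset.sum_congr rfl fun i _ => ?_
  rw [partialDeriv]
  have hL : Δ v = fun y => ∑ j, fderiv ℝ (fderiv ℝ v) y (EuclideanSpace.single j 1)
      (EuclideanSpace.single j 1) := funext (laplacian_eq_sum v)
  rw [hL, fderiv_fun_sum fun j _ => ((h2.clm_apply contDiffAt_const).clm_apply
    contDiffAt_const).differentiableAt_of_one, laplacian_eq_sum]
  simp only [sum_apply, hD]
  refine congrArg (fun y : EuclideanSpace ℝ (Fin D) => y i) (Finset.sum_congr rfl fun j _ => ?_)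
  rw [fderiv_fderiv_comm h1, hs]

end SecondOrder

/-! ### Time and space derivatives of jointly smooth fields. -/

section TimeDependent

variable {E F : Type*} [NormedAddCommGroup E] [NormedSpace ℝ E] [NormedAddCommGroup F]
  [NormedSpace ℝ F] {w : ℝ → E → F} {t : ℝ} {x : E}

theorem hasFDerivAt_space (h : DifferentiableAt ℝ (fun z : ℝ × E => w z.1 z.2) (t, x)) :
    HasFDerivAt (w t) ((fderiv ℝ (fun z : ℝ × E => w z.1 z.2) (t, x)).comp
      (ContinuousLinearMap.inr ℝ ℝ E)) x :=
  h.hasFDerivAt.comp x (hasFDerivAt_prodMk_right t x)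

theorem hasDerivAt_time (h : DifferentiableAt ℝ (fun z : ℝ × E => w z.1 z.2) (t, x)) :
    HasDerivAt (fun s => w s x) (fderiv ℝ (fun z : ℝ × E => w z.1 z.2) (t, x) (1, 0)) t := by
  have := (h.hasFDerivAt.comp t (hasFDerivAt_prodMk_left t x)).hasDerivAt
  exact this.congr_deriv (by simp)

theorem eventually_contDiffAt_prod {n : ℕ}
    (h : ContDiffAt ℝ n (fun z : ℝ × E => w z.1 z.2) (t, x)) :
    (∀ᶠ s in 𝓝 t, ContDiffAt ℝ n (fun z : ℝ × E => w z.1 z.2) (s, x)) ∧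
      ∀ᶠ y in 𝓝 x, ContDiffAt ℝ n (fun z : ℝ × E => w z.1 z.2) (t, y) := by
  have hev := h.eventually (by simp)
  exact ⟨(Continuous.prodMk_left x).continuousAt.tendsto.eventually hev,
    (Continuous.prodMk_right t).continuousAt.tendsto.eventually hev⟩

/-- Both sides are values of the second derivative on `ℝ × E` at `(1, 0)` and `(0, e)`; its symmetry
exchanges the time and space derivatives. -/
theorem hasDerivAt_fderiv_space (h : ContDiffAt ℝ 2 (fun z : ℝ × E => w z.1 z.2) (t, x)) (e : E) :
    HasDerivAt (fun s => fderiv ℝ (w s) x e)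
      (fderiv ℝ (fun y => deriv (fun s => w s y) t) x e) t := by
  obtain ⟨hs, hy⟩ := eventually_contDiffAt_prod (n := 2) h
  have h1 : (fun s => fderiv ℝ (w s) x e)
      =ᶠ[𝓝 t] fun s => fderiv ℝ (fun z : ℝ × E => w z.1 z.2) (s, x) (0, e) := by
    filter_upwards [hs] with s hs
    rw [(hasFDerivAt_space (hs.differentiableAt (by norm_num))).fderiv]
    simp
  have h2 : (fun y => deriv (fun s => w s y) t)
      =ᶠ[𝓝 x] fun y => fderiv ℝ (fun z : ℝ × E => w z.1 z.2) (t, y) (1, 0) := by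
    filter_upwards [hy] with y hy
    exact (hasDerivAt_time (hy.differentiableAt (by norm_num))).deriv
  have hd := (h.fderiv_right (m := 1) (by norm_num)).differentiableAt_of_one
  rw [h2.fderiv_eq]
  refine HasDerivAt.congr_of_eventuallyEq ?_ h1
  have e1 := (hasDerivAt_time (w := fun s y => fderiv ℝ (fun z : ℝ × E => w z.1 z.2) (s, y))
    (t := t) (x := x) hd).clm_apply (hasDerivAt_const t ((0 : ℝ), e))
  have e2 := ((hasFDerivAt_space (w := fun s y => fderiv ℝ (fun z : ℝ × E => w z.1 z.2) (s, y))
    (t := t) (x := x) hd).clm_apply (hasFDerivAt_const ((1 : ℝ), (0 : E)) x)).fderiv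
  rw [e2]
  refine e1.congr_deriv ?_
  have := fderiv_fderiv_comm h (1, 0) (0, e)
  simpa using this

theorem continuousAt_deriv_time (h : ContDiffAt ℝ 2 (fun z : ℝ × E => w z.1 z.2) (t, x)) :
    ContinuousAt (fun z : ℝ × E => deriv (fun s => w s z.2) z.1) (t, x) := by
  have hev : ∀ᶠ z in 𝓝 (t, x), ContDiffAt ℝ 2 (fun z : ℝ × E => w z.1 z.2) z :=
    h.eventually (by simp)
  have h2 : (fun z : ℝ × E => fderiv ℝ (fun z : ℝ × E => w z.1 z.2) z (1, 0))
      =ᶠ[𝓝 (t, x)] fun z : ℝ × E => deriv (fun s => w s z.2) z.1 := by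
    filter_upwards [hev] with z hz
    exact (hasDerivAt_time (hz.differentiableAt (by norm_num))).deriv.symm
  exact ((h.of_le (by norm_num)).continuousAt_fderiv_of_one.clm_apply
    continuousAt_const).congr h2

theorem continuousAt_fderiv_space (h : ContDiffAt ℝ 2 (fun z : ℝ × E => w z.1 z.2) (t, x)) :
    ContinuousAt (fun z : ℝ × E => fderiv ℝ (w z.1) z.2) (t, x) := by
  have hev : ∀ᶠ z in 𝓝 (t, x), ContDiffAt ℝ 2 (fun z : ℝ × E => w z.1 z.2) z :=
    h.eventually (by simp)
  have h2 : (fun z : ℝ × E => (fderiv ℝ (fun z : ℝ × E => w z.1 z.2) z).comp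
      (ContinuousLinearMap.inr ℝ ℝ E)) =ᶠ[𝓝 (t, x)] fun z : ℝ × E => fderiv ℝ (w z.1) z.2 := by
    filter_upwards [hev] with z hz
    exact (hasFDerivAt_space (hz.differentiableAt (by norm_num))).fderiv.symm
  exact ((h.of_le (by norm_num)).continuousAt_fderiv_of_one.clm_comp
    continuousAt_const).congr h2

end TimeDependent

variable {D : ℕ} {w : ℝ → EuclideanSpace ℝ (Fin D) → EuclideanSpace ℝ (Fin D)} {t : ℝ}
  {x : EuclideanSpace ℝ (Fin D)}

theorem hasDerivAt_divergence
    (h : ContDiffAt ℝ 2 (fun z : ℝ × EuclideanSpace ℝ (Fin D) => w z.1 z.2) (t, x)) :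
    HasDerivAt (fun s => divergence (w s) x)
      (divergence (fun y => deriv (fun s => w s y) t) x) t := by
  refine HasDerivAt.fun_sum fun i _ => ?_
  exact (EuclideanSpace.proj (𝕜 := ℝ) i).hasFDerivAt.comp_hasDerivAt t
    (hasDerivAt_fderiv_space h (EuclideanSpace.single i 1))

end GePUPE

/-! ### The kinetic energy: pointwise identities and differentiation in time. -/

namespace GePUPE

open Filter

variable {D : ℕ}

section KineticEnergyDensity

variable {v : EuclideanSpace ℝ (Fin D) → EuclideanSpace ℝ (Fin D)}
  {x : EuclideanSpace ℝ (Fin D)}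

/-- The kinetic energy density `½ v · v`. -/
noncomputable def energyDensity (v : EuclideanSpace ℝ (Fin D) → EuclideanSpace ℝ (Fin D))
    (x : EuclideanSpace ℝ (Fin D)) : ℝ :=
  (1 / 2 : ℝ) * ⟪v x, v x⟫

theorem contDiffAt_energyDensity {n : WithTop ℕ∞} (hv : ContDiffAt ℝ n v x) :
    ContDiffAt ℝ n (energyDensity v) x :=
  contDiffAt_const.mul (hv.inner ℝ hv)

theorem fderiv_energyDensity (hv : DifferentiableAt ℝ v x) (e : EuclideanSpace ℝ (Fin D)) :
    fderiv ℝ (energyDensity v) x e = ⟪v x, fderiv ℝ v x e⟫ := by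
  have h := ((hv.hasFDerivAt.inner ℝ hv.hasFDerivAt).const_mul (1 / 2 : ℝ)).fderiv
  have h2 : fderiv ℝ (energyDensity v) x = _ := h
  rw [h2]
  simp [real_inner_comm]
  ring

/-- This identity replaces Green's formula for `∫ ⟪v, Δv⟫`: what remains to integrate is the
divergence of the single field `∇(½|v|²)`. -/
theorem laplacian_energyDensity (hv : ContDiffAt ℝ 2 v x) :
    Δ (energyDensity v) x = ⟪v x, Δ v x⟫ + ∑ i, ∑ j, |partialDeriv i j v x| ^ 2 := by
  rw [laplacian_eq_sum, laplacian_eq_sum, inner_sum, Finset.sum_comm, ← Finset.sum_add_distrib]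
  refine Finset.sum_congr rfl fun j _ => ?_
  have hev : ∀ᶠ y in 𝓝 x, ContDiffAt ℝ 2 v y := hv.eventually (by simp)
  have hd := (contDiffAt_energyDensity hv).fderiv_right (m := 1) (by norm_num)
  have hdv := hv.fderiv_right (m := 1) (by norm_num)
  set e : EuclideanSpace ℝ (Fin D) := EuclideanSpace.single j 1 with he
  have h1 : fderiv ℝ (fderiv ℝ (energyDensity v)) x e e
      = fderiv ℝ (fun y => fderiv ℝ (energyDensity v) y e) x e := by
    rw [(hd.differentiableAt_of_one.hasFDerivAt.clm_apply (hasFDerivAt_const e x)).fderiv]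
    simp
  have h2 : (fun y => fderiv ℝ (energyDensity v) y e) =ᶠ[𝓝 x] fun y => ⟪v y, fderiv ℝ v y e⟫ := by
    filter_upwards [hev] with y hy
    exact fderiv_energyDensity (hy.differentiableAt (by norm_num)) e
  have h3 : HasFDerivAt (fun y => fderiv ℝ v y e) ((fderiv ℝ (fderiv ℝ v) x).flip e) x := by
    have := hdv.differentiableAt_of_one.hasFDerivAt.clm_apply (hasFDerivAt_const e x)
    simpa using this
  rw [h1, h2.fderiv_eq,
    ((hv.differentiableAt (by norm_num)).hasFDerivAt.inner ℝ h3).fderiv]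
  have h4 : ∑ i, |partialDeriv i j v x| ^ 2 = ⟪fderiv ℝ v x e, fderiv ℝ v x e⟫ := by
    rw [real_inner_self_eq_norm_sq, EuclideanSpace.norm_sq_eq]
    rfl
  rw [h4]
  simp

end KineticEnergyDensity

section Energy

variable {Ω : Set (EuclideanSpace ℝ (Fin D))}
  {w : ℝ → EuclideanSpace ℝ (Fin D) → EuclideanSpace ℝ (Fin D)} {t : ℝ}

/-- Differentiation of the kinetic energy under the integral sign. -/
theorem hasDerivAt_kineticEnergy (hΩ : IsOpen Ω) (hb : Bornology.IsBounded Ω)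
    (hw : ∀ x ∈ closure Ω,
      ContDiffAt ℝ 2 (fun z : ℝ × EuclideanSpace ℝ (Fin D) => w z.1 z.2) (t, x)) :
    HasDerivAt (fun s => kineticEnergy Ω (w s)) (∫ x in Ω, ⟪w t x, deriv (fun s => w s x) t⟫) t := by
  have hK := hb.isCompact_closure
  -- Compactness of the closure gives one time radius valid for all `x`, on both sides of `t` even
  -- when `t` is an end point of the time interval.
  have hev : ∀ᶠ s in 𝓝 t, ∀ x ∈ closure Ω,
      ContDiffAt ℝ 2 (fun z : ℝ × EuclideanSpace ℝ (Fin D) => w z.1 z.2) (s, x) :=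
    hK.eventually_forall_of_forall_eventually fun x hx => (hw x hx).eventually (by simp)
  obtain ⟨r, hr, hball⟩ := Metric.nhds_basis_closedBall.eventually_iff.1 hev
  have hcw : ∀ s ∈ Metric.closedBall t r, ∀ x ∈ closure Ω, ContinuousAt (w s) x :=
    fun s hs x hx => (hball hs x hx).continuousAt.comp
      (f := fun y => (s, y)) (Continuous.prodMk_right s).continuousAt
  have hcont : ContinuousOn (fun z : ℝ × EuclideanSpace ℝ (Fin D) =>
      ⟪w z.1 z.2, deriv (fun s => w s z.2) z.1⟫) (Metric.closedBall t r ×ˢ closure Ω) := by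
    rintro ⟨s, x⟩ ⟨hs, hx⟩
    exact ((hball hs x hx).continuousAt.inner (𝕜 := ℝ)
      (continuousAt_deriv_time (hball hs x hx))).continuousWithinAt
  obtain ⟨C, hC⟩ := ((isCompact_closedBall t r).prod hK).exists_bound_of_continuousOn hcont
  have htr : t ∈ Metric.closedBall t r := Metric.mem_closedBall_self hr.le
  have hcd : ContinuousOn (fun x => ⟪w t x, deriv (fun s => w s x) t⟫) (closure Ω) := by
    exact hcont.comp (f := fun x => (t, x)) (Continuous.prodMk_right t).continuousOn
      fun x hx => ⟨htr, hx⟩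
  have hce : ∀ s ∈ Metric.closedBall t r,
      ContinuousOn (fun x => (1 / 2 : ℝ) * ⟪w s x, w s x⟫) (closure Ω) := fun s hs x hx =>
    (continuousAt_const.mul ((hcw s hs x hx).inner (𝕜 := ℝ) (hcw s hs x hx))).continuousWithinAt
  have key := hasDerivAt_integral_of_dominated_loc_of_deriv_le (μ := volume.restrict Ω)
    (F := fun s x => (1 / 2 : ℝ) * ⟪w s x, w s x⟫)
    (F' := fun s x => ⟪w s x, deriv (fun s => w s x) s⟫) (x₀ := t) (bound := fun _ => C)
    (s := Metric.closedBall t r) (Metric.closedBall_mem_nhds t hr) ?_ ?_ ?_ ?_ ?_ ?_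
  · refine key.2.congr_of_eventuallyEq (Eventually.of_forall fun s => ?_)
    simp only [kineticEnergy, integral_const_mul]
  · filter_upwards [Metric.closedBall_mem_nhds t hr] with s hs
    exact (integrableOn_of_continuousOn_closure hb (hce s hs)).aestronglyMeasurable
  · exact integrableOn_of_continuousOn_closure hb (hce t htr)
  · exact (integrableOn_of_continuousOn_closure hb hcd).aestronglyMeasurable
  · exact (ae_restrict_iff' hΩ.measurableSet).2 (ae_of_all _ fun x hx s hs =>
      hC (s, x) ⟨hs, subset_closure hx⟩)
  · exact integrableOn_const hb.measure_lt_top.ne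
  · refine (ae_restrict_iff' hΩ.measurableSet).2 (ae_of_all _ fun x hx s hs => ?_)
    have h1 := hasDerivAt_time (w := w)
      ((hball hs x (subset_closure hx)).differentiableAt (by norm_num))
    have h2 : HasDerivAt (fun s => w s x) (deriv (fun s => w s x) s) s :=
      h1.differentiableAt.hasDerivAt
    refine ((h2.inner ℝ h2).const_mul (1 / 2 : ℝ)).congr_deriv ?_
    rw [real_inner_comm (w s x)]
    ring

end Energy

theorem eq_of_eqOn_of_mem_closure {Ω : Set (EuclideanSpace ℝ (Fin D))}
    {f g : EuclideanSpace ℝ (Fin D) → EuclideanSpace ℝ (Fin D)} {x : EuclideanSpace ℝ (Fin D)}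
    (hf : ContinuousAt f x) (hg : ContinuousAt g x) (hx : x ∈ closure Ω)
    (h : ∀ y ∈ Ω, f y = g y) : f x = g x := by
  have := mem_closure_iff_nhdsWithin_neBot.1 hx
  refine tendsto_nhds_unique (hf.tendsto.mono_left nhdsWithin_le_nhds) (Tendsto.congr' ?_
    (hg.tendsto.mono_left (nhdsWithin_le_nhds (s := Ω))))
  filter_upwards [self_mem_nhdsWithin] with y hy using (h y hy).symm

/-! ### Consequences of the GePUP-E system. -/

namespace IsSolution

variable {Ω : Set (EuclideanSpace ℝ (Fin D))} {I : Set ℝ} {t₀ ν lam : ℝ}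
  {g u w : ℝ → EuclideanSpace ℝ (Fin D) → EuclideanSpace ℝ (Fin D)}
  {q : ℝ → EuclideanSpace ℝ (Fin D) → ℝ}

/-- The divergence of `w` satisfies the heat equation. -/
theorem hasDerivAt_divergence_w (h : IsSolution Ω I t₀ ν lam g u w q) (hΩ : IsOpen Ω) {t : ℝ}
    (ht : t ∈ I) {x : EuclideanSpace ℝ (Fin D)} (hx : x ∈ Ω) :
    HasDerivAt (fun s => divergence (w s) x) (ν * Δ (divergence (w t)) x) t := by
  have hx' := subset_closure hx
  refine (hasDerivAt_divergence (h.contDiffAt_w t ht x hx')).congr_deriv ?_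
  have hg := (h.contDiffAt_g t ht x hx').differentiableAt_of_one
  have hc := (contDiffAt_convection (h.contDiffAt_u t ht x hx')).differentiableAt_of_one
  have hq := h.contDiffAt_q t ht x hx'
  have hqd := (contDiffAt_gradient hq).differentiableAt_of_one
  have hw := h.contDiffAt_w_space t ht x hx'
  have hwd := (contDiffAt_laplacian hw).differentiableAt_of_one
  have he : (fun y => deriv (fun s => w s y) t) =ᶠ[𝓝 x]
      fun y => g t y - convection (u t) y - ∇ (q t) y + ν • Δ (w t) y := by
    filter_upwards [hΩ.mem_nhds hx] with y hy using h.momentum t ht y hy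
  -- The Poisson equation makes `∇ · (g - u · ∇u)` cancel `∇ · ∇q`, leaving `ν ∇ · Δw = ν Δ(∇ · w)`.
  rw [divergence_congr he, divergence_add ((hg.fun_sub hc).fun_sub hqd) (hwd.fun_const_smul ν),
    divergence_sub (hg.fun_sub hc) hqd, ← h.poisson_q t ht x hx, divergence_gradient hq,
    divergence_smul (differentiableAt_const ν) hwd, divergence_laplacian hw]
  simp

/-- The maximum principle is applied to `∇ · w` and to its negative. The initial values vanish in
`Ω` because `w = u` there, and on `∂Ω` by the boundary condition. -/
theorem divergence_w_eq_zero (h : IsSolution Ω I t₀ ν lam g u w q) (hΩ : IsC1Domain Ω)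
    (hI : I.OrdConnected) (ht₀ : IsLeast I t₀) (hν : 0 < ν) {t : ℝ} (ht : t ∈ I)
    {x : EuclideanSpace ℝ (Fin D)} (hx : x ∈ closure Ω) : divergence (w t) x = 0 := by
  have hsub : Icc t₀ t ⊆ I := hI.out ht₀.1 ht
  have htt : t ∈ Icc t₀ t := ⟨ht₀.2 ht, le_rfl⟩
  have hc : ContinuousOn (fun z : ℝ × EuclideanSpace ℝ (Fin D) => divergence (w z.1) z.2)
      (Icc t₀ t ×ˢ closure Ω) := by
    rintro ⟨s, y⟩ ⟨hs, hy⟩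
    have h1 := (traceCLM D).continuous.continuousAt.tendsto.comp
      (continuousAt_fderiv_space (h.contDiffAt_w s (hsub hs) y hy)).tendsto
    simp only [divergence_eq_traceCLM]
    exact ContinuousAt.continuousWithinAt h1
  have h0 : ∀ y ∈ closure Ω, divergence (w t₀) y = 0 := by
    intro y hy
    by_cases hyΩ : y ∈ Ω
    · have : w t₀ =ᶠ[𝓝 y] u t₀ := by
        filter_upwards [hΩ.isOpen.mem_nhds hyΩ] with z hz using h.initial z (subset_closure hz)
      rw [divergence_congr this]
      exact (h.projection t₀ ht₀.1).divergence_eq_zero y hyΩ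
    · exact h.divergence_w t₀ ht₀.1 y (by rw [hΩ.isOpen.frontier_eq]; exact ⟨hy, hyΩ⟩)
  have h2 : ∀ s ∈ Icc t₀ t, ∀ y ∈ Ω, ContDiffAt ℝ 2 (divergence (w s)) y := fun s hs y hy =>
    contDiffAt_divergence (h.contDiffAt_w_space s (hsub hs) y (subset_closure hy))
  have hle := nonpos_of_heat_equation hΩ.isOpen hΩ.isBounded hν.le
    (f := fun s => divergence (w s)) hc (fun y hy => (h0 y hy).le)
    (fun s hs y hy => (h.divergence_w s (hsub hs) y hy).le) h2
    (fun s hs y hy => h.hasDerivAt_divergence_w hΩ.isOpen (hsub hs) hy) t htt x hx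
  have hge := nonpos_of_heat_equation hΩ.isOpen hΩ.isBounded hν.le
    (f := fun s => -divergence (w s)) hc.neg (fun y hy => by simp [h0 y hy])
    (fun s hs y hy => by simp [h.divergence_w s (hsub hs) y hy]) (fun s hs y hy => (h2 s hs y hy).neg)
    (fun s hs y hy => by
      rw [InnerProductSpace.laplacian_neg, Pi.neg_apply, mul_neg]
      exact (h.hasDerivAt_divergence_w hΩ.isOpen (hsub hs) hy).neg) t htt x hx
  simp only [Pi.neg_apply] at hge
  linarith

/-- The momentum equation extends to `∂Ω` by continuity of both sides; subtracting the Neumann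
condition for `q` leaves only the penalty term. -/
theorem inner_deriv_w_normal (h : IsSolution Ω I t₀ ν lam g u w q) {t : ℝ}
    (ht : t ∈ I) {x n : EuclideanSpace ℝ (Fin D)} (hx : x ∈ frontier Ω)
    (hn : IsUnitOuterNormal Ω x n) : ⟪deriv (fun s => w s x) t, n⟫ = -lam * ⟪w t x, n⟫ := by
  have hx' := frontier_subset_closure hx
  have hm : deriv (fun s => w s x) t
      = g t x - convection (u t) x - ∇ (q t) x + ν • Δ (w t) x := by
    refine eq_of_eqOn_of_mem_closure (f := fun x => deriv (fun s => w s x) t)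
      (g := fun x => g t x - convection (u t) x - ∇ (q t) x + ν • Δ (w t) x) ?_ ?_ hx'
      (h.momentum t ht)
    · exact (continuousAt_deriv_time (h.contDiffAt_w t ht x hx')).comp
        (f := fun y => (t, y)) (Continuous.prodMk_right t).continuousAt
    · exact (((h.contDiffAt_g t ht x hx').continuousAt.sub
        (contDiffAt_convection (h.contDiffAt_u t ht x hx')).continuousAt).sub
        (contDiffAt_gradient (h.contDiffAt_q t ht x hx')).continuousAt).add
        ((contDiffAt_laplacian (h.contDiffAt_w_space t ht x hx')).continuousAt.const_smul ν)
  have hq := h.neumann_q t ht x hx n hn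
  rw [hm, real_inner_comm, real_inner_comm n (w t x)]
  simp only [inner_add_right, inner_sub_right] at hq ⊢
  linarith

theorem inner_w_normal (h : IsSolution Ω I t₀ ν lam g u w q)
    (hI : I.OrdConnected) (ht₀ : IsLeast I t₀) {t : ℝ} (ht : t ∈ I)
    {x n : EuclideanSpace ℝ (Fin D)} (hx : x ∈ frontier Ω) (hn : IsUnitOuterNormal Ω x n) :
    ⟪w t x, n⟫ = 0 := by
  have hx' := frontier_subset_closure hx
  have hsub : Icc t₀ t ⊆ I := hI.out ht₀.1 ht
  -- Integrating factor for the linear equation `y' = -lam * y` satisfied by `y = w · n`.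
  have hd : ∀ s ∈ Icc t₀ t, HasDerivAt (fun s => Real.exp (lam * s) * ⟪w s x, n⟫) 0 s := by
    intro s hs
    have h1 : HasDerivAt (fun s => w s x) (deriv (fun s => w s x) s) s :=
      (hasDerivAt_time ((h.contDiffAt_w s (hsub hs) x hx').differentiableAt
        (by norm_num))).differentiableAt.hasDerivAt
    have h2 := h1.inner ℝ (hasDerivAt_const s n)
    have h3 : HasDerivAt (fun s => Real.exp (lam * s)) (Real.exp (lam * s) * lam) s := by
      simpa using ((hasDerivAt_id s).const_mul lam).exp
    refine (h3.mul h2).congr_deriv ?_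
    rw [h.inner_deriv_w_normal (hsub hs) hx hn, inner_zero_right]
    ring
  have hconst := constant_of_has_deriv_right_zero
    (fun s hs => (hd s hs).continuousAt.continuousWithinAt)
    (fun s hs => (hd s (Ico_subset_Icc_self hs)).hasDerivWithinAt) t ⟨ht₀.2 ht, le_rfl⟩
  rw [h.initial x hx', h.normal_u t₀ ht₀.1 x hx n hn, mul_zero] at hconst
  exact (mul_eq_zero.1 hconst).resolve_left (Real.exp_ne_zero _)

theorem w_eq_zero (h : IsSolution Ω I t₀ ν lam g u w q) (hΩ : IsC1Domain Ω)
    (hI : I.OrdConnected) (ht₀ : IsLeast I t₀) {t : ℝ} (ht : t ∈ I)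
    {x : EuclideanSpace ℝ (Fin D)} (hx : x ∈ frontier Ω) : w t x = 0 := by
  obtain ⟨n, hn, -⟩ := hΩ.exists_isUnitOuterNormal hx
  -- With zero normal component, `w t x` is itself a tangent vector and can be paired with itself in
  -- the tangential condition.
  exact inner_self_eq_zero.1
    (h.tangential_w t ht x hx n hn (w t x) (h.inner_w_normal hI ht₀ ht hx hn))

theorem w_eq_u (h : IsSolution Ω I t₀ ν lam g u w q) (hΩ : IsC1Domain Ω)
    (hI : I.OrdConnected) (ht₀ : IsLeast I t₀) (hν : 0 < ν) {t : ℝ} (ht : t ∈ I)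
    {x : EuclideanSpace ℝ (Fin D)} (hx : x ∈ Ω) : w t x = u t x := by
  obtain ⟨ψ, hψ⟩ := (h.projection t ht).decomposition
  have hw : ∀ y ∈ closure Ω, ContDiffAt ℝ 1 (w t) y := fun y hy =>
    (h.contDiffAt_w_space t ht y hy).of_le (by norm_num)
  have hu : ∀ y ∈ closure Ω, ContDiffAt ℝ 1 (u t) y := fun y hy =>
    (h.contDiffAt_u t ht y hy).of_le (by norm_num)
  refine sub_eq_zero.1 (eq_zero_of_solenoidal_of_gradient hΩ (v := fun y => w t y - u t y)
    (fun y hy => (hw y hy).sub (hu y hy)) (fun y hy => ?_) (fun y hy n hn => ?_) hψ x hx)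
  · have hy' := subset_closure hy
    rw [divergence_sub (hw y hy').differentiableAt_of_one (hu y hy').differentiableAt_of_one,
      h.divergence_w_eq_zero hΩ hI ht₀ hν ht hy', (h.projection t ht).divergence_eq_zero y hy,
      sub_zero]
  · rw [inner_sub_left, h.inner_w_normal hI ht₀ ht hy hn, h.normal_u t ht y hy n hn, sub_zero]

/-- The energy balance of `w` at a fixed time. -/
theorem setIntegral_inner_deriv (h : IsSolution Ω I t₀ ν lam g u w q) (hΩ : IsC1Domain Ω)
    (hI : I.OrdConnected) (ht₀ : IsLeast I t₀) (hν : 0 < ν) (hg : IsConservative Ω I g) {t : ℝ}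
    (ht : t ∈ I) :
    ∫ x in Ω, ⟪w t x, deriv (fun s => w s x) t⟫ = -ν * gradNormSq Ω (w t) := by
  obtain ⟨φ, hφ⟩ := hg
  have hw3 : ∀ y ∈ closure Ω, ContDiffAt ℝ 3 (w t) y := h.contDiffAt_w_space t ht
  have hw2 : ∀ y ∈ closure Ω, ContDiffAt ℝ 2 (w t) y := fun y hy => (hw3 y hy).of_le (by norm_num)
  have hw1 : ∀ y ∈ closure Ω, ContDiffAt ℝ 1 (w t) y := fun y hy => (hw3 y hy).of_le (by norm_num)
  have hdiv : ∀ y ∈ Ω, divergence (w t) y = 0 := fun y hy =>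
    h.divergence_w_eq_zero hΩ hI ht₀ hν ht (subset_closure hy)
  have hn : ∀ y ∈ frontier Ω, ∀ n, IsUnitOuterNormal Ω y n → ⟪w t y, n⟫ = 0 := fun y hy n hn =>
    h.inner_w_normal hI ht₀ ht hy hn
  have hgc : ∀ y ∈ closure Ω, ContinuousAt (fun x => -g t x) y := fun y hy =>
    (h.contDiffAt_g t ht y hy).continuousAt.neg
  have hqc : ∀ y ∈ closure Ω, ContinuousAt (∇ (q t)) y := fun y hy =>
    (contDiffAt_gradient (h.contDiffAt_q t ht y hy)).continuousAt
  have hec : ∀ y ∈ closure Ω, ContDiffAt ℝ 1 (∇ (energyDensity (w t))) y := fun y hy =>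
    contDiffAt_gradient (contDiffAt_energyDensity (hw2 y hy))
  have z1 := setIntegral_inner_gradient_eq_zero hΩ hw1 hdiv hn hgc (hφ t ht)
  have z2 := setIntegral_inner_gradient_eq_zero hΩ hw1 hdiv hn hqc fun y hy =>
    ((h.contDiffAt_q t ht y (subset_closure hy)).differentiableAt (by norm_num)).hasGradientAt
  have z3 := setIntegral_inner_gradient_eq_zero hΩ hw1 hdiv hn
    (fun y hy => (hec y hy).continuousAt) fun y hy =>
    (contDiffAt_energyDensity (hw1 y (subset_closure hy))).differentiableAt_of_one.hasGradientAt
  -- The flux of `∇(½|w|²)` through `∂Ω` is zero because each component `⟪w, ∂ᵢw⟫` vanishes where `w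
  -- = 0`.
  have z4 : ∫ x in Ω, divergence (∇ (energyDensity (w t))) x = 0 := by
    refine setIntegral_divergence_eq_zero hΩ hec fun y hy n _ => ?_
    have : ∇ (energyDensity (w t)) y = 0 := by
      ext i
      rw [gradient_apply, fderiv_energyDensity
        (hw1 y (frontier_subset_closure hy)).differentiableAt_of_one,
        h.w_eq_zero hΩ hI ht₀ ht hy, inner_zero_left]
      rfl
    rw [this, inner_zero_left]
  have int : ∀ {f : EuclideanSpace ℝ (Fin D) → ℝ}, (∀ y ∈ closure Ω, ContinuousAt f y) →
      IntegrableOn f Ω := fun hf =>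
    integrableOn_of_continuousOn_closure hΩ.isBounded fun y hy => (hf y hy).continuousWithinAt
  have i1 := int fun y hy => (hw1 y hy).continuousAt.inner (𝕜 := ℝ) (hgc y hy)
  have i2 := int fun y hy => (hw1 y hy).continuousAt.inner (𝕜 := ℝ) (hqc y hy)
  have i3 := int fun y hy => (hw1 y hy).continuousAt.inner (𝕜 := ℝ) (hec y hy).continuousAt
  have i4 := int fun y hy => continuousAt_divergence (hec y hy)
  have i5 : ∀ i j, IntegrableOn (fun x => |partialDeriv i j (w t) x| ^ 2) Ω := fun i j =>
    int fun y hy => (((EuclideanSpace.proj (𝕜 := ℝ) i).continuous.continuousAt.comp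
      ((hw1 y hy).continuousAt_fderiv_of_one.clm_apply
        (continuousAt_const (y := EuclideanSpace.single j (1 : ℝ))))).abs).pow 2
  have i6 : IntegrableOn (fun x => ∑ i, ∑ j, |partialDeriv i j (w t) x| ^ 2) Ω :=
    integrable_finsetSum _ fun i _ => integrable_finsetSum _ fun j _ => i5 i j
  have hgn : ∫ x in Ω, ∑ i, ∑ j, |partialDeriv i j (w t) x| ^ 2 = gradNormSq Ω (w t) := by
    rw [integral_finsetSum _ fun i _ => integrable_finsetSum _ fun j _ => i5 i j]
    exact Finset.sum_congr rfl fun i _ => integral_finsetSum _ fun j _ => i5 i j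
  have hpt : ∀ x ∈ Ω, ⟪w t x, deriv (fun s => w s x) t⟫
      = -⟪w t x, -g t x⟫ - ⟪w t x, ∇ (q t) x⟫ - ⟪w t x, ∇ (energyDensity (w t)) x⟫
        + (ν * divergence (∇ (energyDensity (w t))) x
          - ν * ∑ i, ∑ j, |partialDeriv i j (w t) x| ^ 2) := by
    intro x hx
    have hx' := subset_closure hx
    -- Convection contains a derivative, so equality of `u` and `w` is needed on a neighbourhood of
    -- `x`.
    have hwu : u t =ᶠ[𝓝 x] w t := by
      filter_upwards [hΩ.isOpen.mem_nhds hx] with y hy using (h.w_eq_u hΩ hI ht₀ hν ht hy).symm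
    have hconv : convection (u t) x = convection (w t) x := by
      simp only [convection, hwu.fderiv_eq, hwu.self_of_nhds]
    have hen : ⟪w t x, ∇ (energyDensity (w t)) x⟫ = ⟪w t x, convection (w t) x⟫ := by
      rw [real_inner_comm, ← fderiv_apply_eq_inner_gradient
        (contDiffAt_energyDensity (hw1 x hx')).differentiableAt_of_one,
        fderiv_energyDensity (hw1 x hx').differentiableAt_of_one]
      rfl
    rw [h.momentum t ht x hx, hconv, hen, divergence_gradient (contDiffAt_energyDensity (hw2 x hx')),
      laplacian_energyDensity (hw2 x hx')]
    simp only [inner_add_right, inner_sub_right, inner_neg_right, inner_smul_right]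
    ring
  have j1 : IntegrableOn (fun x => -⟪w t x, -g t x⟫) Ω := i1.neg
  have j2 : IntegrableOn (fun x => -⟪w t x, -g t x⟫ - ⟪w t x, ∇ (q t) x⟫) Ω := j1.sub i2
  have j3 : IntegrableOn (fun x => -⟪w t x, -g t x⟫ - ⟪w t x, ∇ (q t) x⟫
      - ⟪w t x, ∇ (energyDensity (w t)) x⟫) Ω := j2.sub i3
  have j4 : IntegrableOn (fun x => ν * divergence (∇ (energyDensity (w t))) x
      - ν * ∑ i, ∑ j, |partialDeriv i j (w t) x| ^ 2) Ω := (i4.const_mul ν).sub (i6.const_mul ν)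
  rw [setIntegral_congr_fun hΩ.isOpen.measurableSet hpt, integral_add j3 j4, integral_sub j2 i3,
    integral_sub j1 i2, integral_sub (i4.const_mul ν) (i6.const_mul ν), integral_neg,
    integral_const_mul, integral_const_mul, z1, z2, z3, z4, hgn]
  ring

end IsSolution

end GePUPE

theorem mainTheorem5 {D : ℕ} (Ω : Set (EuclideanSpace ℝ (Fin D))) (hΩ : GePUPE.IsC1Domain Ω)
    (I : Set ℝ) (hI : I.OrdConnected) (t₀ : ℝ) (ht₀ : IsLeast I t₀)
    (ν lam : ℝ) (hν : 0 < ν) (hlam : 0 ≤ lam)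
    (g u w : ℝ → EuclideanSpace ℝ (Fin D) → EuclideanSpace ℝ (Fin D))
    (q : ℝ → EuclideanSpace ℝ (Fin D) → ℝ)
    (hsol : GePUPE.IsSolution Ω I t₀ ν lam g u w q)
    (hg : GePUPE.IsConservative Ω I g) :
    ∀ t ∈ I, HasDerivWithinAt (fun s => GePUPE.kineticEnergy Ω (u s))
      (-ν * GePUPE.gradNormSq Ω (u t)) I t := by
  intro t ht
  -- No regularity of `u` in time is given. Its energy agrees with that of `w` at times in `I`, so
  -- the derivative transfers within `I`.
  have hE : ∀ s ∈ I, GePUPE.kineticEnergy Ω (u s) = GePUPE.kineticEnergy Ω (w s) := by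
    intro s hs
    unfold GePUPE.kineticEnergy
    congr 1
    refine setIntegral_congr_fun hΩ.isOpen.measurableSet fun x hx => ?_
    simp only [hsol.w_eq_u hΩ hI ht₀ hν hs hx]
  have hG : GePUPE.gradNormSq Ω (u t) = GePUPE.gradNormSq Ω (w t) := by
    unfold GePUPE.gradNormSq
    refine Finset.sum_congr rfl fun i _ => Finset.sum_congr rfl fun j _ =>
      setIntegral_congr_fun hΩ.isOpen.measurableSet fun x hx => ?_
    have hwu : u t =ᶠ[𝓝 x] w t := by
      filter_upwards [hΩ.isOpen.mem_nhds hx] with y hy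
      exact (hsol.w_eq_u hΩ hI ht₀ hν ht hy).symm
    simp only [GePUPE.partialDeriv, hwu.fderiv_eq]
  have hd := GePUPE.hasDerivAt_kineticEnergy hΩ.isOpen hΩ.isBounded (hsol.contDiffAt_w t ht)
  rw [hsol.setIntegral_inner_deriv hΩ hI ht₀ hν hg ht, ← hG] at hd
  exact hd.hasDerivWithinAt.congr hE (hE t ht)
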